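/- Let $\mu$ be a measure on $\mathbb R$ and $c:\mathbb R\to(0,\infty)$ measurable, and put $\Theta=\{\eta:\int c(y)e^{y\eta}\,\mu(dy)<\infty\}$ and $b(\eta)=\log\int c(y)e^{y\eta}\,\mu(dy)$. Let $u$ be a twice continuously differentiable function on an open interval $D\subseteq\mathbb R$ (for instance $D=\mathbb R$) with values in the interior of $\Theta$, which comes from a link function $g$, that is, $g(\dot b(u(t)))=t$ for all $t\in D$ (so that $u=\dot b^{-1}\circ g^{-1}$). Let $x_1,x_2,\dots\in\mathbb R^p$ be fixed covariates, let $w_1,w_2,\dots>0$ be fixed weights, and let $\mathcal B\subseteq\mathbb R^p$ be the parameter space (for instance $\mathcal B=\mathbb R^p$), where $x_k^t\beta\in D$ for all $k$ and all $\beta\in\mathcal B$. Let $\beta_0\in\mathcal B$ be the true parameter. The responses $y_1,y_2,\dots$ are independent, and $y_k$ has the law $c(y)\exp\{y\theta_k-b(\theta_k)\}\,\mu(dy)$ with $\theta_k=u(x_k^t\beta_0)$. Put $$l_n(\beta)=\sum_{i=1}^n w_i\,[y_i\,u(x_i^t\beta)-b(u(x_i^t\beta))],\qquad I_n(\beta_0)=\sum_{i=1}^n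 w_i\,\dot u(x_i^t\beta_0)^2\,\ddot b(u(x_i^t\beta_0))\,x_ix_i^t .$$ Assume: (H.1) all eigenvalues of $I_n(\beta_0)$ tend to $\infty$ as $n\to\infty$, and there are $d_1,d_2>0$ such that the largest eigenvalue of $I_n(\beta_0)$ lies between $d_1n$ and $d_2n$ for all large $n$; (H.2) there is $L>0$ with $|x_{ij}|\le L$ for all $i,j$; (H.3) for every $\beta\in\mathcal B$, the suprema over $k$ of $|\ddot u(x_k^t\beta)|$, $|\dot u(x_k^t\beta)|$ and $\ddot b(u(x_k^t\beta))$ are finite; (H.4) there is $W>0$ with $w_k\le W$ for all $k$, and there are $c_l,c_u>0$ such that $I_n(\beta_0)-c_l\,n\,I_p$ and $c_u\,n\,I_p-I_n(\beta_0)$ are non-negative definite for all large $n$. Let $\alpha\subseteq\{1,\dots,p\}$ be an incorrect sub-model, that is, $\beta_{0j}\ne0$ for some $j\notin\alpha$. For $v\in\mathbb R^{\alpha}$ write $l_n(v)=\sum_{i=1}^n w_i\,[y_i\,u(x_{i\alpha}^tv)-b(u(x_{i\alpha}^tv))]$, where $x_{i\alpha}$ is the sub-vector of $x_i$ indexed by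 $\alpha$. Let $\hat\beta_n(\alpha)$ be such that, almost surely, for all large $n$ it is a weighted maximum likelihood estimate in the sub-model, that is, it maximises $l_n(v)$ over those $v\in\mathbb R^\alpha$ whose extension by zeros to $\mathbb R^p$ lies in $\mathcal B$. Then $$\limsup_{n\to\infty}\ n^{-1}\{l_n(\hat\beta_n(\alpha))-l_n(\beta_0)\}<0\qquad\text{almost surely.}$$ -/

import Mathlib

open MeasureTheory ProbabilityTheory Filter Topology

namespace GLM

noncomputable section

/-- The natural parameter space `Θ = {η : ∫ c(y) exp(y η) μ(dy) < ∞}` (for positive `c`). -/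
def natParamSpace (μ : Measure ℝ) (c : ℝ → ℝ) : Set ℝ :=
  {η | Integrable (fun y => c y * Real.exp (y * η)) μ}

/-- The function `b` of the exponential family, i.e. the normalising function
`b(η) = log ∫ c(y) exp(y η) μ(dy)` which makes `c(y) exp(y η - b(η)) μ(dy)` a probability law. -/
def logPartition (μ : Measure ℝ) (c : ℝ → ℝ) (η : ℝ) : ℝ :=
  Real.log (∫ y, c y * Real.exp (y * η) ∂μ)

/-- The law `c(y) exp(y θ - b(θ)) μ(dy)`. -/
def expFamilyLaw (μ : Measure ℝ) (c : ℝ → ℝ) (θ : ℝ) : Measure ℝ :=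
  μ.withDensity
    (fun y => ENNReal.ofReal (c y * Real.exp (y * θ - logPartition μ c θ)))

/-- The weighted log-likelihood
`l_n(β) = ∑_{i} w_i [y_i u(x_iᵗ β) - b(u(x_iᵗ β))]` of the first `n` observations, for
covariates and coefficients indexed by `ι`. -/
def logLik {ι : Type*} [Fintype ι] (b u : ℝ → ℝ) (w : ℕ → ℝ) (x : ℕ → ι → ℝ)
    (n : ℕ) (y : ℕ → ℝ) (β : ι → ℝ) : ℝ :=
  ∑ i ∈ Finset.range n, w i * (y i * u (x i ⬝ᵥ β) - b (u (x i ⬝ᵥ β)))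

/-- The Fisher information at the true parameter,
`I_n(β₀) = ∑_{i} w_i u'(x_iᵗ β₀)² b''(u(x_iᵗ β₀)) x_i x_iᵗ`. -/
def fisherInfo {p : ℕ} (b u : ℝ → ℝ) (w : ℕ → ℝ) (x : ℕ → Fin p → ℝ) (β₀ : Fin p → ℝ)
    (n : ℕ) : Matrix (Fin p) (Fin p) ℝ :=
  ∑ i ∈ Finset.range n,
    (w i * (deriv u (x i ⬝ᵥ β₀)) ^ 2 * deriv (deriv b) (u (x i ⬝ᵥ β₀))) •
      Matrix.vecMulVec (x i) (x i)

theorem fisherInfo_isHermitian {p : ℕ} (b u : ℝ → ℝ) (w : ℕ → ℝ) (x : ℕ → Fin p → ℝ)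
    (β₀ : Fin p → ℝ) (n : ℕ) : (fisherInfo b u w x β₀ n).IsHermitian := by
  ext i j
  simp only [fisherInfo, Matrix.conjTranspose_apply, Matrix.sum_apply, Matrix.smul_apply,
    Matrix.vecMulVec_apply, smul_eq_mul, star_trivial]
  exact Finset.sum_congr rfl fun k _ => by ring

/-- All eigenvalues of the Fisher information tend to infinity, and its largest eigenvalue is
eventually between two positive multiples of `n`. -/
def InfoEigenvalueCondition {p : ℕ} (b u : ℝ → ℝ) (w : ℕ → ℝ) (x : ℕ → Fin p → ℝ)
    (β₀ : Fin p → ℝ) : Prop :=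
  (∀ j : Fin p,
    Tendsto (fun n => (fisherInfo_isHermitian b u w x β₀ n).eigenvalues j) atTop atTop) ∧
  ∃ d₁ > (0 : ℝ), ∃ d₂ > (0 : ℝ), ∀ᶠ n : ℕ in atTop,
    d₁ * n ≤ ⨆ j, (fisherInfo_isHermitian b u w x β₀ n).eigenvalues j ∧
    ⨆ j, (fisherInfo_isHermitian b u w x β₀ n).eigenvalues j ≤ d₂ * n

/-- The covariates are uniformly bounded. -/
def BoundedDesign {p : ℕ} (x : ℕ → Fin p → ℝ) : Prop :=
  ∃ L > (0 : ℝ), ∀ i j, |x i j| ≤ L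

/-- At every `β` of the parameter space `B`, the quantities `|u''(x_kᵗ β)|`, `|u'(x_kᵗ β)|` and
`b''(u(x_kᵗ β))` are bounded in `k`. -/
def ParamSpaceCondition {p : ℕ} (b u : ℝ → ℝ) (x : ℕ → Fin p → ℝ)
    (B : Set (Fin p → ℝ)) : Prop :=
  ∀ β ∈ B,
    BddAbove (Set.range fun k => |deriv (deriv u) (x k ⬝ᵥ β)|) ∧
    BddAbove (Set.range fun k => |deriv u (x k ⬝ᵥ β)|) ∧
    BddAbove (Set.range fun k => deriv (deriv b) (u (x k ⬝ᵥ β)))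

/-- The weights are uniformly bounded, and eventually `c_l n I_p ≼ I_n(β₀) ≼ c_u n I_p` in the
Loewner order. -/
def RestrictedEigenvalueCondition {p : ℕ} (b u : ℝ → ℝ) (w : ℕ → ℝ) (x : ℕ → Fin p → ℝ)
    (β₀ : Fin p → ℝ) : Prop :=
  (∃ W > (0 : ℝ), ∀ k, w k ≤ W) ∧
  ∃ cl > (0 : ℝ), ∃ cu > (0 : ℝ), ∀ᶠ n : ℕ in atTop,
    (fisherInfo b u w x β₀ n - (cl * n) • (1 : Matrix (Fin p) (Fin p) ℝ)).PosSemidef ∧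
    ((cu * n) • (1 : Matrix (Fin p) (Fin p) ℝ) - fisherInfo b u w x β₀ n).PosSemidef

/-- The sub-vectors `x_{iα}` of the covariates indexed by the sub-model `α`. -/
def subDesign {p : ℕ} (x : ℕ → Fin p → ℝ) (α : Finset (Fin p)) : ℕ → α → ℝ :=
  fun i j => x i j

/-- A coefficient vector of the sub-model `α`, augmented with zeros outside `α`. -/
def augment {p : ℕ} (α : Finset (Fin p)) (v : α → ℝ) : Fin p → ℝ :=
  fun j => if h : j ∈ α then v ⟨j, h⟩ else 0

/-- `v` is a (weighted) maximum likelihood estimate in the sub-model `α` from the first `n`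
observations, for the parameter space `B`. -/
def IsSubmodelMLE {p : ℕ} (b u : ℝ → ℝ) (w : ℕ → ℝ) (x : ℕ → Fin p → ℝ)
    (B : Set (Fin p → ℝ)) (α : Finset (Fin p)) (n : ℕ) (y : ℕ → ℝ) (v : α → ℝ) : Prop :=
  augment α v ∈ B ∧
    IsMaxOn (logLik b u w (subDesign x α) n y) {v' | augment α v' ∈ B} v

/-- The sub-model `α` is incorrect: it misses a nonzero coefficient. -/
def IsIncorrectModel {p : ℕ} (β₀ : Fin p → ℝ) (α : Finset (Fin p)) : Prop :=
  ∃ j, j ∉ α ∧ β₀ j ≠ 0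

end

end GLM

/-! Divided by `2 * W`, the difference of weighted log-likelihoods at β and β₀ is a sum of
log-likelihood ratios with exponents `w i / (2 * W) ≤ 1/2`. For fixed β, moments of such order `s`
are at most `exp (-2 s * midGap)` (`lintegral_exp_llr_le`). The information bound forces the gaps to
be bounded below on a positive weighted proportion of the observations once β is away from β₀
(`exists_weight_far_ge`, `exists_le_midGap`). By independence, the moment of the product decays
exponentially in `n`.

The estimate is random and the parameter space may be unbounded, so the bound has to be uniform in
β. For one observation the likelihood ratio is quasi-concave in θ, and its supremum has moments of
order at most 1/2 bounded by a universal constant (`exists_lintegral_biSup_exp_llr_le`). Hence the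
natural parameters split into `N` order-convex cells, `N` the same for all observations, on which
taking the supremum costs only ε in mean (`exists_monotoneOn_cells`). Cell indices are monotone in a
linear functional of β, so by Sauer–Shelah only polynomially many cell patterns occur
(`card_patterns_le`). A union bound and Borel–Cantelli finish (`ae_eventually_forall_sum_llr_lt`):
vectors of an incorrect sub-model stay at a fixed distance from β₀, so the estimates are covered. -/

/-! ### Counting cell patterns by Sauer–Shelah -/

/-- A family of sets cut out by linear functionals: whenever a point `s` separates two members, the
functional at `s` orders their coefficient vectors. Such a family shatters no set with more points
than the dimension. -/
theorem Finset.Shatters.card_le_of_dotProduct_lt {S : Type*} [DecidableEq S] {p : ℕ}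
    {𝒜 : Finset (Finset S)} (x : S → Fin p → ℝ) (c : Finset S → Fin p → ℝ)
    (hsep : ∀ A ∈ 𝒜, ∀ A' ∈ 𝒜, ∀ s, s ∈ A → s ∉ A' → x s ⬝ᵥ c A' < x s ⬝ᵥ c A)
    {T : Finset S} (hT : 𝒜.Shatters T) : T.card ≤ p := by
  by_contra! hcard
  have hrank : Module.finrank ℝ (Fin p → ℝ) < Fintype.card T := by simpa using hcard
  have hdep : ¬ LinearIndependent ℝ (fun s : T => x s) := fun h =>
    absurd h.fintype_card_le_finrank (not_le.2 hrank)
  obtain ⟨g, hg0, s₀, hs₀⟩ := Fintype.not_linearIndependent_iff.1 hdep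
  -- Shattering realises the sign pattern of the dependency `g`: `A` picks out its positive
  -- coefficients, `A'` its negative ones. Pairing the dependency with `c A - c A'` then gives a sum
  -- that is both zero and positive.
  obtain ⟨A, hA, hTA⟩ := hT (t := T.filter fun s => ∃ h : s ∈ T, 0 < g ⟨s, h⟩)
    (Finset.filter_subset _ _)
  obtain ⟨A', hA', hTA'⟩ := hT (t := T.filter fun s => ∃ h : s ∈ T, g ⟨s, h⟩ < 0)
    (Finset.filter_subset _ _)
  have hmem : ∀ s : T, (s : S) ∈ A ↔ 0 < g s := fun s => by
    have := Finset.ext_iff.1 hTA s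
    simpa [s.2] using this
  have hmem' : ∀ s : T, (s : S) ∈ A' ↔ g s < 0 := fun s => by
    have := Finset.ext_iff.1 hTA' s
    simpa [s.2] using this
  have hzero : ∑ s : T, g s * (x s ⬝ᵥ (c A - c A')) = 0 := by
    have : (∑ s : T, g s • x s) ⬝ᵥ (c A - c A') = 0 := by rw [hg0, zero_dotProduct]
    rw [sum_dotProduct] at this
    simpa only [smul_dotProduct, smul_eq_mul] using this
  have hterm : ∀ s : T, g s ≠ 0 → 0 < g s * (x s ⬝ᵥ (c A - c A')) := by
    intro s hs
    rw [dotProduct_sub]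
    rcases lt_or_gt_of_ne hs with h | h
    · have := hsep A' hA' A hA s ((hmem' s).2 h) (fun h' => by linarith [(hmem s).1 h'])
      exact mul_pos_of_neg_of_neg h (by linarith)
    · have := hsep A hA A' hA' s ((hmem s).2 h) (fun h' => by linarith [(hmem' s).1 h'])
      exact mul_pos h (by linarith)
  have hpos : 0 < ∑ s : T, g s * (x s ⬝ᵥ (c A - c A')) := by
    refine Finset.sum_pos' (fun s _ => ?_) ⟨s₀, Finset.mem_univ _, hterm s₀ hs₀⟩
    by_cases hs : g s = 0
    · simp [hs]
    · exact (hterm s hs).le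
  exact hpos.ne' hzero

theorem Nat.sum_Iic_choose_le_succ_pow (m p : ℕ) :
    ∑ k ∈ Finset.Iic p, m.choose k ≤ (m + 1) ^ p := by
  induction p with
  | zero =>
    have : Finset.Iic 0 = {0} := rfl
    simp [this]
  | succ p ih =>
    have h : Finset.Iic (p + 1) = insert (p + 1) (Finset.Iic p) := by
      ext k; simp; omega
    rw [h, Finset.sum_insert (by simp)]
    calc m.choose (p + 1) + ∑ k ∈ Finset.Iic p, m.choose k
        ≤ m ^ (p + 1) + (m + 1) ^ p := add_le_add (Nat.choose_le_pow _ _) ih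
      _ ≤ m * (m + 1) ^ p + (m + 1) ^ p := by
        gcongr
        rw [pow_succ']
        gcongr
        omega
      _ = (m + 1) ^ (p + 1) := by ring

/-- The number of patterns `i ↦ κ i v` produced by `n` cell indices with `N` values, each of which
is monotone in a linear functional of `v`, is polynomial in `n`. -/
theorem card_patterns_le {n N p : ℕ} (x : Fin n → Fin p → ℝ) (V : Set (Fin p → ℝ))
    (κ : Fin n → (Fin p → ℝ) → Fin N)
    (hκ : ∀ i, ∀ v ∈ V, ∀ v' ∈ V, κ i v' < κ i v → x i ⬝ᵥ v' < x i ⬝ᵥ v)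
    (F : Finset (Fin n → Fin N)) (hF : ∀ J ∈ F, ∃ v ∈ V, ∀ i, κ i v = J i) :
    F.card ≤ (n * N + 1) ^ p := by
  classical
  -- The region below the graph of a pattern: membership of `(i, k)` is the threshold statement `k ≤
  -- κ i v`, which a linear functional orders.
  let A : (Fin n → Fin N) → Finset (Fin n × Fin N) := fun J =>
    Finset.univ.filter fun q => q.2 ≤ J q.1
  have hA : Function.Injective A := by
    intro J J' h
    funext i
    have h1 := Finset.ext_iff.1 h (i, J i)
    have h2 := Finset.ext_iff.1 h (i, J' i)
    simp only [A, Finset.mem_filter, Finset.mem_univ, true_and, le_refl, true_iff, iff_true]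
      at h1 h2
    exact le_antisymm h1 h2
  have hex : ∀ B : Finset (Fin n × Fin N), ∃ v : Fin p → ℝ, B ∈ F.image A →
      v ∈ V ∧ ∀ q, q ∈ B ↔ q.2 ≤ κ q.1 v := by
    intro B
    by_cases hB : B ∈ F.image A
    · obtain ⟨J, hJ, rfl⟩ := Finset.mem_image.1 hB
      obtain ⟨v, hv, hvJ⟩ := hF J hJ
      exact ⟨v, fun _ => ⟨hv, fun q => by simp [A, hvJ]⟩⟩
    · exact ⟨0, fun h => absurd h hB⟩
  choose c hc using hex
  have hdim : (F.image A).vcDim ≤ p := by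
    refine Finset.sup_le fun T hT => ?_
    refine (Finset.mem_shatterer.1 hT).card_le_of_dotProduct_lt (fun q => x q.1) c ?_
    intro B hB B' hB' q hq hq'
    obtain ⟨hv, h⟩ := hc B hB
    obtain ⟨hv', h'⟩ := hc B' hB'
    rw [h] at hq
    rw [h', not_le] at hq'
    exact hκ q.1 _ hv _ hv' (hq'.trans_le hq)
  calc F.card = (F.image A).card := (Finset.card_image_of_injective _ hA).symm
    _ ≤ _ := Finset.card_le_card_shatterer _
    _ ≤ ∑ k ∈ Finset.Iic (F.image A).vcDim, (Fintype.card (Fin n × Fin N)).choose k :=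
      Finset.card_shatterer_le_sum_vcDim
    _ ≤ ∑ k ∈ Finset.Iic p, (Fintype.card (Fin n × Fin N)).choose k :=
      Finset.sum_le_sum_of_subset (Finset.Iic_subset_Iic.2 hdim)
    _ ≤ (n * N + 1) ^ p := by
      simpa using Nat.sum_Iic_choose_le_succ_pow (n * N) p

/-! ### Suprema of semicontinuous families and bracketing cells -/

theorem measurable_biSup_of_lowerSemicontinuous {G : ℝ → ℝ → ENNReal} {K : Set ℝ}
    (hG : ∀ θ ∈ K, LowerSemicontinuous (G θ)) : Measurable fun y => ⨆ θ ∈ K, G θ y :=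
  (lowerSemicontinuous_biSup hG).measurable

/-- The real line is second countable, so countably many members already attain the supremum at
every point. This makes monotone convergence available for an uncountable index set. -/
theorem exists_countable_biSup_eq {G : ℝ → ℝ → ENNReal} {K : Set ℝ}
    (hG : ∀ θ ∈ K, LowerSemicontinuous (G θ)) :
    ∃ T ⊆ K, T.Countable ∧ ∀ y, ⨆ θ ∈ T, G θ y = ⨆ θ ∈ K, G θ y := by
  have hlub : IsLUB (G '' K) (fun y => ⨆ θ ∈ K, G θ y) := by
    have h : (fun y => ⨆ θ ∈ K, G θ y) = sSup (G '' K) := by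
      funext y
      rw [sSup_image]
      simp only [iSup_apply]
    rw [h]
    exact isLUB_sSup _
  obtain ⟨F, hF, hFc, hFlub⟩ := exists_countable_lowerSemicontinuous_isLUB
    (by rintro _ ⟨θ, hθ, rfl⟩; exact hG θ hθ) hlub
  obtain ⟨T, hTK, hT⟩ := Set.SurjOn.exists_bijOn_subset hF
  have hTc : T.Countable := by
    refine Set.countable_of_injective_of_countable_image hT.injOn ?_
    rw [hT.image_eq]
    exact hFc
  rw [← hT.image_eq] at hFlub
  refine ⟨T, hTK, hTc, fun y => ?_⟩
  have h := congrFun (hFlub.unique (isLUB_sSup _)) y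
  rw [h, sSup_image]
  simp only [iSup_apply]

/-- A bound for the supremum over all compact subintervals of an index set is a bound for the
supremum over the whole index set. -/
theorem lintegral_biSup_le_of_Icc {P : Measure ℝ} {G : ℝ → ℝ → ENNReal} {K : Set ℝ}
    (hG : ∀ θ ∈ K, LowerSemicontinuous (G θ)) {C : ENNReal}
    (h : ∀ a ∈ K, ∀ b ∈ K, ∫⁻ y, ⨆ θ ∈ K ∩ Set.Icc a b, G θ y ∂P ≤ C) :
    ∫⁻ y, ⨆ θ ∈ K, G θ y ∂P ≤ C := by
  classical
  obtain ⟨T, hTK, hTc, hT⟩ := exists_countable_biSup_eq hG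
  have : Countable T := hTc
  -- A countable supremum is a directed supremum over finite subsets, each lying between its own
  -- minimum and maximum.
  have heq : ∀ y, ⨆ θ ∈ K, G θ y = ⨆ F : Finset T, ⨆ θ ∈ F, G θ y := fun y => by
    rw [← hT y, iSup_subtype', iSup_eq_iSup_finset]
  simp_rw [heq]
  rw [lintegral_iSup_directed]
  · refine iSup_le fun F => ?_
    rcases F.eq_empty_or_nonempty with rfl | hF
    · simp
    · refine le_trans (lintegral_mono fun y => ?_)
        (h (F.min' hF) (hTK (F.min' hF).2) (F.max' hF) (hTK (F.max' hF).2))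
      refine iSup₂_le fun θ hθ => ?_
      exact le_iSup₂_of_le (θ : ℝ)
        ⟨hTK θ.2, F.min'_le θ hθ, F.le_max' θ hθ⟩ le_rfl
  · intro F
    exact (LowerSemicontinuous.measurable
      (lowerSemicontinuous_biSup (p := fun θ : T => θ ∈ F)
        fun θ _ => hG θ (hTK θ.2))).aemeasurable
  · refine Monotone.directed_le fun F F' hFF' y => ?_
    exact biSup_mono fun θ hθ => hFF' hθ

/-- For a quasi-concave family `G θ` with an integrable envelope, the index interval splits into
boundedly many cells on which the supremum of `G` exceeds each `G θ` by little on average. -/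
theorem exists_monotoneOn_cells {C ε : ℝ} (hC : 0 ≤ C) (hε : 0 < ε) {N : ℕ} (hN : 2 * C / ε < N)
    {P : Measure ℝ} {G : ℝ → ℝ → ENNReal} {I : Set ℝ}
    (hlsc : ∀ θ ∈ I, LowerSemicontinuous (G θ))
    (hqc : ∀ y, ∀ a ∈ I, ∀ b ∈ I, ∀ θ ∈ I, a ≤ θ → θ ≤ b → min (G a y) (G b y) ≤ G θ y)
    (hsup : ∫⁻ y, ⨆ θ ∈ I, G θ y ∂P ≤ ENNReal.ofReal C) :
    ∃ κ : ℝ → Fin N, MonotoneOn κ I ∧ ∀ θ ∈ I,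
      ∫⁻ y, ⨆ θ' ∈ {θ' ∈ I | κ θ' = κ θ}, G θ' y ∂P ≤ ∫⁻ y, G θ y ∂P + ENNReal.ofReal ε := by
  let A : ℝ → ℝ → ENNReal := fun θ y => ⨆ θ' ∈ I ∩ Set.Iic θ, G θ' y
  let B : ℝ → ℝ → ENNReal := fun θ y => ⨆ θ' ∈ I ∩ Set.Ici θ, G θ' y
  have hAm : ∀ θ, Measurable (A θ) := fun θ =>
    measurable_biSup_of_lowerSemicontinuous fun θ' h => hlsc θ' h.1
  have hBm : ∀ θ, Measurable (B θ) := fun θ =>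
    measurable_biSup_of_lowerSemicontinuous fun θ' h => hlsc θ' h.1
  have hAC : ∀ θ, ∫⁻ y, A θ y ∂P ≤ ENNReal.ofReal C := fun θ =>
    (lintegral_mono fun y => biSup_mono fun θ' h => h.1).trans hsup
  have hBC : ∀ θ, ∫⁻ y, B θ y ∂P ≤ ENNReal.ofReal C := fun θ =>
    (lintegral_mono fun y => biSup_mono fun θ' h => h.1).trans hsup
  have hAfin : ∀ θ, ∫⁻ y, A θ y ∂P ≠ ⊤ := fun θ => ((hAC θ).trans_lt ENNReal.ofReal_lt_top).ne
  have hBfin : ∀ θ, ∫⁻ y, B θ y ∂P ≠ ⊤ := fun θ => ((hBC θ).trans_lt ENNReal.ofReal_lt_top).ne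
  have hAmono : ∀ {s t : ℝ}, s ≤ t → ∀ y, A s y ≤ A t y := fun hst y =>
    biSup_mono fun θ' h => ⟨h.1, le_trans h.2 hst⟩
  have hBanti : ∀ {s t : ℝ}, s ≤ t → ∀ y, B t y ≤ B s y := fun hst y =>
    biSup_mono fun θ' h => ⟨h.1, le_trans hst h.2⟩
  let a : ℝ → ℝ := fun θ => (∫⁻ y, A θ y ∂P).toReal
  let d : ℝ → ℝ := fun θ => (∫⁻ y, B θ y ∂P).toReal
  have ha : ∀ {s t : ℝ}, s ≤ t → a s ≤ a t := fun hst =>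
    ENNReal.toReal_mono (hAfin _) (lintegral_mono (hAmono hst))
  have hd : ∀ {s t : ℝ}, s ≤ t → d t ≤ d s := fun hst =>
    ENNReal.toReal_mono (hBfin _) (lintegral_mono (hBanti hst))
  have ha0 : ∀ θ, 0 ≤ a θ := fun θ => ENNReal.toReal_nonneg
  have hd0 : ∀ θ, 0 ≤ d θ := fun θ => ENNReal.toReal_nonneg
  have haC : ∀ θ, a θ ≤ C := fun θ => ENNReal.toReal_le_of_le_ofReal hC (hAC θ)
  have hdC : ∀ θ, d θ ≤ C := fun θ => ENNReal.toReal_le_of_le_ofReal hC (hBC θ)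
  -- The mean left envelope increases and the mean right envelope decreases, so `V` is monotone with
  -- values in `[0, 2C/ε]`. The cells are the level sets of its floor: within one cell the two
  -- envelopes together vary by at most ε.
  let V : ℝ → ℝ := fun θ => (a θ + (C - d θ)) / ε
  have hV0 : ∀ θ, 0 ≤ V θ := fun θ => div_nonneg (by linarith [ha0 θ, hdC θ]) hε.le
  have hVmono : ∀ {s t : ℝ}, s ≤ t → V s ≤ V t := fun hst => by
    have := ha hst
    have := hd hst
    exact div_le_div_of_nonneg_right (by linarith) hε.le
  have hVN : ∀ θ, ⌊V θ⌋₊ < N := fun θ => by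
    rw [Nat.floor_lt (hV0 θ)]
    refine lt_of_le_of_lt (div_le_div_of_nonneg_right ?_ hε.le) hN
    linarith [haC θ, hd0 θ]
  refine ⟨fun θ => ⟨⌊V θ⌋₊, hVN θ⟩, fun s _ t _ hst => Nat.floor_mono (hVmono hst), ?_⟩
  intro θ hθ
  have hclose : ∀ s t, ⌊V s⌋₊ = ⌊V θ⌋₊ → ⌊V t⌋₊ = ⌊V θ⌋₊ → V t - V s ≤ 1 := by
    intro s t hs ht
    have h1 := Nat.floor_le (hV0 s)
    have h2 := Nat.lt_floor_add_one (V t)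
    rw [ht] at h2
    rw [hs] at h1
    linarith
  refine lintegral_biSup_le_of_Icc (fun θ' h => hlsc θ' h.1) ?_
  rintro s ⟨hsI, hs⟩ t ⟨htI, ht⟩
  -- The interval is enlarged to contain `θ` without leaving the cell.
  have hs' : ⌊V (min s θ)⌋₊ = ⌊V θ⌋₊ := by
    rcases min_choice s θ with h | h <;> rw [h]
    exact congrArg Fin.val hs
  have ht' : ⌊V (max t θ)⌋₊ = ⌊V θ⌋₊ := by
    rcases max_choice t θ with h | h <;> rw [h]
    exact congrArg Fin.val ht
  set s' := min s θ with hs'def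
  set t' := max t θ with ht'def
  have hs'θ : s' ≤ θ := min_le_right _ _
  have ht'θ : θ ≤ t' := le_max_right _ _
  have hVle := hclose s' t' hs' ht'
  have hinc : (a t' - a θ) + (d s' - d θ) ≤ ε := by
    simp only [V] at hVle
    rw [← sub_div, div_le_one hε] at hVle
    linarith [ha hs'θ, hd ht'θ]
  have hpt : ∀ y, ⨆ θ' ∈ {θ' ∈ I | (⟨⌊V θ'⌋₊, hVN θ'⟩ : Fin N) = ⟨⌊V θ⌋₊, hVN θ⟩} ∩ Set.Icc s t,
      G θ' y ≤ G θ y + ((A t' y - A θ y) + (B s' y - B θ y)) := by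
    intro y
    refine iSup₂_le ?_
    rintro θ' ⟨⟨hθ'I, -⟩, hsθ', hθ't⟩
    have h1 : G θ' y ≤ A t' y :=
      le_iSup₂_of_le θ' ⟨hθ'I, hθ't.trans (le_max_left _ _)⟩ le_rfl
    have h2 : G θ' y ≤ B s' y :=
      le_iSup₂_of_le θ' ⟨hθ'I, (min_le_left _ _).trans hsθ'⟩ le_rfl
    -- By quasi-concavity `θ` cannot lie strictly below a value on each side, so it attains one of
    -- the two one-sided suprema.
    have h3 : A θ y ≤ G θ y ∨ B θ y ≤ G θ y := by
      by_contra! hcon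
      obtain ⟨h, h'⟩ := hcon
      obtain ⟨p, ⟨hpI, hp⟩, hp'⟩ := lt_biSup_iff.1 h
      obtain ⟨q, ⟨hqI, hq⟩, hq'⟩ := lt_biSup_iff.1 h'
      exact absurd (hqc y p hpI q hqI θ hθ hp hq) (not_le.2 (lt_min hp' hq'))
    rcases h3 with h3 | h3
    · calc G θ' y ≤ A t' y := h1
        _ ≤ A θ y + (A t' y - A θ y) := le_add_tsub
        _ ≤ G θ y + ((A t' y - A θ y) + (B s' y - B θ y)) := add_le_add h3 le_self_add
    · calc G θ' y ≤ B s' y := h2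
        _ ≤ B θ y + (B s' y - B θ y) := le_add_tsub
        _ ≤ G θ y + ((A t' y - A θ y) + (B s' y - B θ y)) := add_le_add h3 le_add_self
  have hGm : Measurable (G θ) := (hlsc θ hθ).measurable
  refine (lintegral_mono hpt).trans ?_
  rw [lintegral_add_left hGm, lintegral_add_left (f := fun y => A t' y - A θ y) ((hAm _).sub (hAm _)),
    lintegral_sub (hAm _) (hAfin _) (ae_of_all _ (hAmono ht'θ)),
    lintegral_sub (hBm _) (hBfin _) (ae_of_all _ (hBanti hs'θ))]
  refine add_le_add le_rfl ?_
  rw [← ENNReal.ofReal_toReal (hAfin t'), ← ENNReal.ofReal_toReal (hAfin θ),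
    ← ENNReal.ofReal_toReal (hBfin s'), ← ENNReal.ofReal_toReal (hBfin θ),
    ← ENNReal.ofReal_sub _ (ha0 θ), ← ENNReal.ofReal_sub _ (hd0 θ),
    ← ENNReal.ofReal_add (sub_nonneg.2 (ha ht'θ)) (sub_nonneg.2 (hd hs'θ))]
  exact ENNReal.ofReal_le_ofReal hinc

/-! ### Moments of likelihood ratios -/

namespace GLM

/-- The log-likelihood ratio `log (dP_θ / dP_θ₀) (y)` in the natural exponential family with
log-partition function `b`. -/
def llr (b : ℝ → ℝ) (θ₀ θ y : ℝ) : ℝ := (θ - θ₀) * y - (b θ - b θ₀)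

/-- The deficit of `b` from affinity at the midpoint: the Bhattacharyya distance of `P_s` and `P_t`. -/
noncomputable def midGap (b : ℝ → ℝ) (s t : ℝ) : ℝ := (b s + b t) / 2 - b ((s + t) / 2)

theorem continuous_llr (b : ℝ → ℝ) (θ₀ θ : ℝ) : Continuous (llr b θ₀ θ) := by
  unfold llr; fun_prop

@[simp] theorem llr_self (b : ℝ → ℝ) (θ₀ y : ℝ) : llr b θ₀ θ₀ y = 0 := by simp [llr]

theorem concaveOn_llr {b : ℝ → ℝ} {I : Set ℝ} (hb : ConvexOn ℝ I b) (θ₀ y : ℝ) :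
    ConcaveOn ℝ I fun θ => llr b θ₀ θ y := by
  refine ⟨hb.1, fun s hs t ht p q hp hq hpq => ?_⟩
  have h := hb.2 hs ht hp hq hpq
  simp only [smul_eq_mul, llr] at h ⊢
  obtain rfl : p = 1 - q := by linarith
  nlinarith

theorem lowerSemicontinuous_exp_llr (b : ℝ → ℝ) (θ₀ θ s : ℝ) :
    LowerSemicontinuous fun y => ENNReal.ofReal (Real.exp (s * llr b θ₀ θ y)) := by
  have := continuous_llr b θ₀ θ
  exact (ENNReal.continuous_ofReal.comp (by fun_prop)).lowerSemicontinuous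

theorem min_exp_llr_le {b : ℝ → ℝ} {I : Set ℝ} (hb : ConvexOn ℝ I b) (θ₀ : ℝ) {s : ℝ}
    (hs : 0 ≤ s) (y a : ℝ) (ha : a ∈ I) (c : ℝ) (hc : c ∈ I) (θ : ℝ) (haθ : a ≤ θ) (hθc : θ ≤ c) :
    min (ENNReal.ofReal (Real.exp (s * llr b θ₀ a y)))
      (ENNReal.ofReal (Real.exp (s * llr b θ₀ c y))) ≤
      ENNReal.ofReal (Real.exp (s * llr b θ₀ θ y)) := by
  have hmono : Monotone fun r : ℝ => ENNReal.ofReal (Real.exp (s * r)) := fun r r' h =>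
    ENNReal.ofReal_le_ofReal (Real.exp_le_exp.2 (mul_le_mul_of_nonneg_left h hs))
  have h := (concaveOn_llr hb θ₀ y).min_le_of_mem_Icc ha hc ⟨haθ, hθc⟩
  exact (hmono.map_min).symm.le.trans (hmono h)

theorem midGap_nonneg {b : ℝ → ℝ} {I : Set ℝ} (hb : ConvexOn ℝ I b) {s t : ℝ} (hs : s ∈ I)
    (ht : t ∈ I) : 0 ≤ midGap b s t := by
  have h := hb.2 hs ht (show (0 : ℝ) ≤ 1 / 2 by norm_num)
      (show (0 : ℝ) ≤ 1 / 2 by norm_num) (by norm_num)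
  simp only [smul_eq_mul] at h
  have e : (1 / 2 : ℝ) * s + 1 / 2 * t = (s + t) / 2 := by ring
  rw [e] at h
  unfold midGap
  linarith

/-- The moments of order at most one half of the likelihood ratio. -/
theorem lintegral_exp_llr_le {b : ℝ → ℝ} {I : Set ℝ} (hb : ConvexOn ℝ I b) {θ₀ : ℝ}
    (hθ₀ : θ₀ ∈ I) {P : Measure ℝ}
    (hP : ∀ θ ∈ I, ∫⁻ y, ENNReal.ofReal (Real.exp (llr b θ₀ θ y)) ∂P = 1)
    {s : ℝ} (hs0 : 0 ≤ s) (hs : s ≤ 1 / 2) {θ : ℝ} (hθ : θ ∈ I) :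
    ∫⁻ y, ENNReal.ofReal (Real.exp (s * llr b θ₀ θ y)) ∂P ≤
      ENNReal.ofReal (Real.exp (-(2 * s * midGap b θ₀ θ))) := by
  have hmid : (θ₀ + θ) / 2 ∈ I := by
    have h := hb.1 hθ₀ hθ (show (0 : ℝ) ≤ 1 / 2 by norm_num)
      (show (0 : ℝ) ≤ 1 / 2 by norm_num) (by norm_num)
    simp only [smul_eq_mul] at h
    convert h using 1
    ring
  -- The `s`-th power tilts towards `τ`. Since `s ≤ 1/2`, `τ` lies between `θ₀` and the midpoint,
  -- and convexity there produces the factor with `midGap`.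
  set τ := θ₀ + s * (θ - θ₀) with hτ
  have hτI : τ ∈ I := by
    have h := hb.1 hθ₀ hθ (show 0 ≤ 1 - s by linarith) hs0 (by ring)
    simp only [smul_eq_mul] at h
    convert h using 1
    rw [hτ]; ring
  have hbτ : b τ ≤ (1 - 2 * s) * b θ₀ + 2 * s * b ((θ₀ + θ) / 2) := by
    have h := hb.2 hθ₀ hmid (show 0 ≤ 1 - 2 * s by linarith) (show 0 ≤ 2 * s by linarith)
      (by ring)
    simp only [smul_eq_mul] at h
    have e : τ = (1 - 2 * s) * θ₀ + 2 * s * ((θ₀ + θ) / 2) := by rw [hτ]; ring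
    rw [e]
    exact h
  have hle : ∀ y, s * llr b θ₀ θ y ≤ -(2 * s * midGap b θ₀ θ) + llr b θ₀ τ y := fun y => by
    unfold llr midGap
    have : (τ - θ₀) * y = s * (θ - θ₀) * y := by rw [hτ]; ring
    nlinarith
  calc ∫⁻ y, ENNReal.ofReal (Real.exp (s * llr b θ₀ θ y)) ∂P
      ≤ ∫⁻ y, ENNReal.ofReal (Real.exp (-(2 * s * midGap b θ₀ θ))) *
          ENNReal.ofReal (Real.exp (llr b θ₀ τ y)) ∂P := by
        refine lintegral_mono fun y => ?_
        rw [← ENNReal.ofReal_mul (Real.exp_nonneg _), ← Real.exp_add]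
        exact ENNReal.ofReal_le_ofReal (Real.exp_le_exp.2 (hle y))
    _ = ENNReal.ofReal (Real.exp (-(2 * s * midGap b θ₀ θ))) := by
        rw [lintegral_const_mul' _ _ ENNReal.ofReal_ne_top, hP τ hτI, mul_one]

end GLM

/-- A chain of open sets of measure at most `C` has a union of measure at most `C`. -/
theorem measure_biUnion_le_of_chain {P : Measure ℝ} {ι : Type*} {K : Set ι} {U : ι → Set ℝ}
    (hU : ∀ i ∈ K, IsOpen (U i)) (hchain : ∀ i ∈ K, ∀ j ∈ K, U i ⊆ U j ∨ U j ⊆ U i)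
    {C : ENNReal} (h : ∀ i ∈ K, P (U i) ≤ C) : P (⋃ i ∈ K, U i) ≤ C := by
  obtain ⟨T, hTK, hTc, hT⟩ := TopologicalSpace.isOpen_biUnion_countable K U hU
  rw [← hT, measure_biUnion_eq_iSup hTc]
  · exact iSup₂_le fun i hi => h i (hTK hi)
  · intro i hi j hj
    rcases hchain i (hTK hi) j (hTK hj) with h | h
    · exact ⟨j, hj, h, subset_rfl⟩
    · exact ⟨i, hi, subset_rfl, h⟩

namespace GLM

theorem measure_lt_llr_le {b : ℝ → ℝ} {θ₀ θ : ℝ} {P : Measure ℝ}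
    (hP : ∫⁻ y, ENNReal.ofReal (Real.exp (llr b θ₀ θ y)) ∂P = 1) (t : ℝ) :
    P {y | t < llr b θ₀ θ y} ≤ ENNReal.ofReal (Real.exp (-t)) := by
  have hm : Measurable fun y => ENNReal.ofReal (Real.exp (llr b θ₀ θ y)) := by
    have := continuous_llr b θ₀ θ
    fun_prop
  have h := meas_ge_le_lintegral_div hm.aemeasurable (μ := P)
    (ε := ENNReal.ofReal (Real.exp t)) (by simp [Real.exp_pos]) ENNReal.ofReal_ne_top
  rw [hP] at h
  refine (measure_mono fun y hy => ?_).trans (h.trans_eq ?_)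
  · exact ENNReal.ofReal_le_ofReal (Real.exp_le_exp.2 (le_of_lt hy))
  · rw [Real.exp_neg, ENNReal.ofReal_inv_of_pos (Real.exp_pos t), one_div]

/-- The maximal likelihood ratio has the tail of a standard exponential variable, up to a factor. -/
theorem measure_exists_lt_llr_le {b : ℝ → ℝ} {I : Set ℝ} {θ₀ : ℝ} {P : Measure ℝ}
    (hP : ∀ θ ∈ I, ∫⁻ y, ENNReal.ofReal (Real.exp (llr b θ₀ θ y)) ∂P = 1) (t : ℝ) :
    P (⋃ θ ∈ I, {y | t < llr b θ₀ θ y}) ≤ 2 * ENNReal.ofReal (Real.exp (-t)) := by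
  have hopen : ∀ θ, IsOpen {y | t < llr b θ₀ θ y} := fun θ =>
    isOpen_lt continuous_const (continuous_llr b θ₀ θ)
  -- On each side of `θ₀` the superlevel sets are half-lines pointing the same way, hence a chain:
  -- their union costs no more than one of them. The two sides give the factor 2.
  have hup : ∀ θ, θ₀ ≤ θ → IsUpperSet {y | t < llr b θ₀ θ y} := by
    intro θ hθ y z hyz hy
    simp only [Set.mem_ofPred_eq, llr] at hy ⊢
    nlinarith
  have hlow : ∀ θ, θ ≤ θ₀ → IsLowerSet {y | t < llr b θ₀ θ y} := by
    intro θ hθ y z hyz hy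
    simp only [Set.mem_ofPred_eq, llr] at hy ⊢
    nlinarith
  have h1 : P (⋃ θ ∈ I ∩ Set.Ici θ₀, {y | t < llr b θ₀ θ y}) ≤ ENNReal.ofReal (Real.exp (-t)) :=
    measure_biUnion_le_of_chain (fun θ _ => hopen θ)
      (fun θ h θ' h' => (hup θ h.2).total (hup θ' h'.2))
      (fun θ h => measure_lt_llr_le (hP θ h.1) t)
  have h2 : P (⋃ θ ∈ I ∩ Set.Iic θ₀, {y | t < llr b θ₀ θ y}) ≤ ENNReal.ofReal (Real.exp (-t)) :=
    measure_biUnion_le_of_chain (fun θ _ => hopen θ)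
      (fun θ h θ' h' => (hlow θ h.2).total (hlow θ' h'.2))
      (fun θ h => measure_lt_llr_le (hP θ h.1) t)
  rw [two_mul]
  refine le_trans (measure_mono ?_) ((measure_union_le _ _).trans (add_le_add h1 h2))
  refine Set.iUnion₂_subset fun θ hθ y hy => ?_
  rcases le_total θ₀ θ with h | h
  · exact Or.inl (Set.mem_biUnion (⟨hθ, h⟩ : θ ∈ I ∩ Set.Ici θ₀) hy)
  · exact Or.inr (Set.mem_biUnion (⟨hθ, h⟩ : θ ∈ I ∩ Set.Iic θ₀) hy)

/-- The maximal likelihood ratio has moments of order at most one half, bounded uniformly over all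
one-parameter exponential families. -/
theorem exists_lintegral_biSup_exp_llr_le : ∃ C : ℝ, 0 ≤ C ∧
    ∀ (b : ℝ → ℝ) (I : Set ℝ) (θ₀ : ℝ) (P : Measure ℝ), θ₀ ∈ I →
      (∀ θ ∈ I, ∫⁻ y, ENNReal.ofReal (Real.exp (llr b θ₀ θ y)) ∂P = 1) →
      ∀ s : ℝ, 0 ≤ s → s ≤ 1 / 2 →
        ∫⁻ y, ⨆ θ ∈ I, ENNReal.ofReal (Real.exp (s * llr b θ₀ θ y)) ∂P ≤ ENNReal.ofReal C := by
  -- On the slice where the log-ratio lies in `(k, k+1]` its `s`-th power is at most `exp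
  -- ((k+1)/2)`, against a tail of `2 * exp (-k)`.
  let a : ℕ → ℝ := fun k => 2 * Real.exp (1 / 2) * Real.exp (k * (-1 / 2))
  have ha0 : ∀ k, 0 ≤ a k := fun k => by positivity
  have hsum : Summable a :=
    (Real.summable_exp_nat_mul_iff.2 (by norm_num)).mul_left _
  refine ⟨1 + ∑' k, a k, add_nonneg zero_le_one (tsum_nonneg ha0), ?_⟩
  intro b I θ₀ P hθ₀ hP s hs0 hs
  have hmass : P Set.univ = 1 := by simpa using hP θ₀ hθ₀
  let U : ℕ → Set ℝ := fun k => ⋃ θ ∈ I, {y | (k : ℝ) < llr b θ₀ θ y}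
  have hUm : ∀ k, MeasurableSet (U k) := fun k =>
    (isOpen_biUnion fun θ _ => isOpen_lt continuous_const (continuous_llr b θ₀ θ)).measurableSet
  let e : ℕ → ENNReal := fun k => ENNReal.ofReal (Real.exp ((k + 1) / 2))
  have hpt : ∀ y, ⨆ θ ∈ I, ENNReal.ofReal (Real.exp (s * llr b θ₀ θ y)) ≤
      1 + ∑' k, (U k).indicator (fun _ => e k) y := by
    intro y
    refine iSup₂_le fun θ hθ => ?_
    rcases le_or_gt (llr b θ₀ θ y) 0 with h | h
    · refine le_trans ?_ le_self_add
      rw [← ENNReal.ofReal_one]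
      refine ENNReal.ofReal_le_ofReal (Real.exp_le_one_iff.2 (mul_nonpos_of_nonneg_of_nonpos hs0 h))
    · obtain ⟨k, hk, hk'⟩ : ∃ k : ℕ, (k : ℝ) < llr b θ₀ θ y ∧ llr b θ₀ θ y ≤ k + 1 := by
        obtain ⟨k, hk⟩ := Nat.exists_eq_succ_of_ne_zero (Nat.ceil_pos.2 h).ne'
        refine ⟨k, Nat.lt_ceil.1 (by omega), ?_⟩
        have := Nat.le_ceil (llr b θ₀ θ y)
        rw [hk] at this
        exact_mod_cast this
      have hy : y ∈ U k := Set.mem_biUnion hθ hk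
      refine le_trans ?_ (le_trans (ENNReal.le_tsum k) le_add_self)
      rw [Set.indicator_of_mem hy]
      refine ENNReal.ofReal_le_ofReal (Real.exp_le_exp.2 ?_)
      nlinarith
  refine (lintegral_mono hpt).trans ?_
  rw [lintegral_add_left measurable_const, lintegral_tsum
    (fun k => (measurable_const.indicator (hUm k)).aemeasurable), lintegral_const, hmass, one_mul,
    ENNReal.ofReal_add zero_le_one (tsum_nonneg ha0), ENNReal.ofReal_one,
    ENNReal.ofReal_tsum_of_nonneg ha0 hsum]
  refine add_le_add le_rfl (ENNReal.tsum_le_tsum fun k => ?_)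
  rw [lintegral_indicator (hUm k), setLIntegral_const]
  calc e k * P (U k) ≤ e k * (2 * ENNReal.ofReal (Real.exp (-k))) := by
        gcongr
        exact measure_exists_lt_llr_le hP k
    _ = ENNReal.ofReal (a k) := by
        have h2 : (2 : ENNReal) = ENNReal.ofReal 2 := by simp
        rw [h2, ← ENNReal.ofReal_mul (by norm_num), ← ENNReal.ofReal_mul (Real.exp_nonneg _)]
        congr 1
        simp only [a]
        rw [mul_left_comm, ← Real.exp_add, mul_assoc, ← Real.exp_add]
        congr 2
        ring

/-! ### The uniform exponential bound -/

/-- `HasLaw` gives only a.e. measurability, so independence is transferred to measurable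
modifications before factorising. -/
theorem lintegral_prod_comp_eq_prod_lintegral {Ω ι : Type*} [Fintype ι] [MeasurableSpace Ω]
    {P : Measure Ω} {Q : ι → Measure ℝ} {y : ι → Ω → ℝ} (hy : iIndepFun y P)
    (hlaw : ∀ i, HasLaw (y i) (Q i) P) {S : ι → ℝ → ENNReal} (hS : ∀ i, Measurable (S i)) :
    ∫⁻ ω, ∏ i, S i (y i ω) ∂P = ∏ i, ∫⁻ t, S i t ∂(Q i) := by
  have hae : ∀ i, y i =ᵐ[P] (hlaw i).aemeasurable.mk _ := fun i =>
    (hlaw i).aemeasurable.ae_eq_mk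
  have hind : iIndepFun (fun i => S i ∘ (hlaw i).aemeasurable.mk (y i)) P :=
    (hy.congr hae).comp S hS
  have h := lintegral_prod_eq_prod_lintegral_of_indepFun Finset.univ _ hind
    fun i => (hS i).comp (hlaw i).aemeasurable.measurable_mk
  have hall : ∀ᵐ ω ∂P, ∀ i, y i ω = (hlaw i).aemeasurable.mk (y i) ω :=
    ae_all_iff.2 fun i => hae i
  calc ∫⁻ ω, ∏ i, S i (y i ω) ∂P
      = ∫⁻ ω, ∏ i, (S i ∘ (hlaw i).aemeasurable.mk (y i)) ω ∂P := by
        refine lintegral_congr_ae ?_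
        filter_upwards [hall] with ω hω
        simp only [Function.comp_apply, hω]
    _ = ∏ i, ∫⁻ ω, (S i ∘ (hlaw i).aemeasurable.mk (y i)) ω ∂P := h
    _ = ∏ i, ∫⁻ t, S i t ∂(Q i) := by
        refine Finset.prod_congr rfl fun i _ => ?_
        have hmap : ∫⁻ t, S i t ∂(Q i) = ∫⁻ t, S i t ∂(P.map (y i)) := by rw [(hlaw i).map_eq]
        rw [hmap, lintegral_map' (hS i).aemeasurable (hlaw i).aemeasurable]
        refine lintegral_congr_ae ?_
        filter_upwards [hae i] with ω hω
        simp only [Function.comp_apply, hω]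

/-- Almost surely, the log-likelihood ratios of all parameters that are uniformly separated from
the truth are eventually below a negative multiple of the sample size, simultaneously. -/
theorem ae_eventually_forall_sum_llr_lt {Ω : Type*} [MeasurableSpace Ω] {P : Measure Ω}
    {b : ℝ → ℝ} {I : Set ℝ} (hb : ConvexOn ℝ I b)
    {θ₀ : ℕ → ℝ} (hθ₀ : ∀ i, θ₀ i ∈ I) {Q : ℕ → Measure ℝ}
    (hQ : ∀ i, ∀ θ ∈ I, ∫⁻ t, ENNReal.ofReal (Real.exp (llr b (θ₀ i) θ t)) ∂(Q i) = 1)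
    {y : ℕ → Ω → ℝ} (hy : iIndepFun y P) (hlaw : ∀ i, HasLaw (y i) (Q i) P)
    {s : ℕ → ℝ} (hs0 : ∀ i, 0 ≤ s i) (hs : ∀ i, s i ≤ 1 / 2)
    {p : ℕ} (x : ℕ → Fin p → ℝ) (V : Set (Fin p → ℝ)) (T : ℕ → (Fin p → ℝ) → ℝ)
    (hTI : ∀ i, ∀ v ∈ V, T i v ∈ I)
    (hT : ∀ i, ∀ v ∈ V, ∀ v' ∈ V, T i v' < T i v → x i ⬝ᵥ v' < x i ⬝ᵥ v)
    {c : ℝ} (hc : 0 < c)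
    (hsep : ∀ᶠ n : ℕ in atTop, ∀ v ∈ V,
      c * n ≤ ∑ i ∈ Finset.range n, (1 - Real.exp (-(2 * s i * midGap b (θ₀ i) (T i v))))) :
    ∀ᵐ ω ∂P, ∀ᶠ n : ℕ in atTop, ∀ v ∈ V,
      ∑ i ∈ Finset.range n, s i * llr b (θ₀ i) (T i v) (y i ω) < -(c / 4 * n) := by
  classical
  obtain ⟨C, hC, hCenv⟩ := exists_lintegral_biSup_exp_llr_le
  have hε : 0 < c / 4 := by positivity
  -- `C` is universal, so `N` depends on `c` only and serves every observation.
  obtain ⟨N, hN⟩ := exists_nat_gt (2 * C / (c / 4))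
  have hcells := fun i => exists_monotoneOn_cells hC hε hN
    (G := fun θ t => ENNReal.ofReal (Real.exp (s i * llr b (θ₀ i) θ t)))
    (fun θ _ => lowerSemicontinuous_exp_llr b (θ₀ i) θ (s i))
    (fun t a ha d hd θ _ => min_exp_llr_le hb (θ₀ i) (hs0 i) t a ha d hd θ)
    (hCenv b I (θ₀ i) (Q i) (hθ₀ i) (hQ i) (s i) (hs0 i) (hs i))
  choose κ hκmono hκ using hcells
  let S : ℕ → Fin N → ℝ → ENNReal := fun i j t =>
    ⨆ θ ∈ {θ ∈ I | κ i θ = j}, ENNReal.ofReal (Real.exp (s i * llr b (θ₀ i) θ t))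
  have hSm : ∀ i j, Measurable (S i j) := fun i j =>
    measurable_biSup_of_lowerSemicontinuous fun θ _ => lowerSemicontinuous_exp_llr b (θ₀ i) θ (s i)
  let F : ∀ n : ℕ, Finset (Fin n → Fin N) := fun n =>
    Finset.univ.filter fun J => ∃ v ∈ V, ∀ i : Fin n, κ i (T i v) = J i
  have hFcard : ∀ n, (F n).card ≤ (n * N + 1) ^ p := fun n => by
    refine card_patterns_le (fun i : Fin n => x i) V (fun i v => κ i (T i v)) ?_ (F n)
      fun J hJ => (Finset.mem_filter.1 hJ).2
    intro i v hv v' hv' h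
    exact hT i v hv v' hv' ((hκmono i).reflect_lt (hTI i v' hv') (hTI i v hv) h)
  let Z : ∀ n : ℕ, (Fin n → Fin N) → Ω → ENNReal := fun n J ω => ∏ i : Fin n, S i (J i) (y i ω)
  let E : ℕ → Set Ω := fun n =>
    ⋃ J ∈ F n, {ω | ENNReal.ofReal (Real.exp (-(c / 4 * n))) ≤ Z n J ω}
  obtain ⟨n₀, hn₀⟩ := eventually_atTop.1 hsep
  -- The separation contributes `-c n` to the exponent and the cells give back `c n / 4`. Markov at
  -- level `exp (-c n / 4)` then leaves `exp (-c n / 2)` per pattern.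
  have hZint : ∀ n, n₀ ≤ n → ∀ J ∈ F n,
      ∫⁻ ω, Z n J ω ∂P ≤ ENNReal.ofReal (Real.exp (-(3 * c / 4 * n))) := by
    intro n hn J hJ
    obtain ⟨v, hv, hvJ⟩ := (Finset.mem_filter.1 hJ).2
    have hind : iIndepFun (fun i : Fin n => y i) P := hy.precomp Fin.val_injective
    rw [lintegral_prod_comp_eq_prod_lintegral hind (fun i => hlaw i) fun i : Fin n => hSm i (J i)]
    calc ∏ i : Fin n, ∫⁻ t, S i (J i) t ∂(Q i)
        ≤ ∏ i : Fin n, ENNReal.ofReal (Real.exp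
            (-(1 - Real.exp (-(2 * s i * midGap b (θ₀ i) (T i v)))) + c / 4)) := by
          refine Finset.prod_le_prod' fun i _ => ?_
          have h1 := hκ i (T i v) (hTI i v hv)
          rw [hvJ i] at h1
          refine h1.trans ((add_le_add (lintegral_exp_llr_le hb (hθ₀ i) (hQ i) (hs0 i) (hs i)
            (hTI i v hv)) le_rfl).trans ?_)
          rw [← ENNReal.ofReal_add (Real.exp_nonneg _) hε.le]
          refine ENNReal.ofReal_le_ofReal ?_
          refine le_trans (le_of_eq ?_) (Real.add_one_le_exp _)
          ring
      _ = ENNReal.ofReal (Real.exp (∑ i ∈ Finset.range n,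
            (-(1 - Real.exp (-(2 * s i * midGap b (θ₀ i) (T i v)))) + c / 4))) := by
          rw [Finset.sum_range, Real.exp_sum,
            ENNReal.ofReal_prod_of_nonneg fun i _ => Real.exp_nonneg _]
      _ ≤ ENNReal.ofReal (Real.exp (-(3 * c / 4 * n))) := by
          refine ENNReal.ofReal_le_ofReal (Real.exp_le_exp.2 ?_)
          rw [Finset.sum_add_distrib, Finset.sum_neg_distrib]
          have := hn₀ n hn v hv
          simp only [Finset.sum_const, Finset.card_range, nsmul_eq_mul]
          nlinarith
  have hZm : ∀ n J, AEMeasurable (Z n J) P := fun n J =>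
    Finset.aemeasurable_fun_prod _ fun i _ =>
      (hSm i (J i)).comp_aemeasurable (hlaw i).aemeasurable
  have hE : ∀ n, n₀ ≤ n → 1 ≤ n → P (E n) ≤
      ENNReal.ofReal ((N + 1) ^ p * ((n : ℝ) ^ p * Real.exp (-(c / 2) * n))) := by
    intro n hn hn1
    calc P (E n) ≤ ∑ J ∈ F n, P {ω | ENNReal.ofReal (Real.exp (-(c / 4 * n))) ≤ Z n J ω} :=
          measure_biUnion_finset_le _ _
      _ ≤ ∑ J ∈ F n, ENNReal.ofReal (Real.exp (-(c / 2) * n)) := by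
          refine Finset.sum_le_sum fun J hJ => ?_
          refine (meas_ge_le_lintegral_div (hZm n J) (by simp [Real.exp_pos])
            ENNReal.ofReal_ne_top).trans ?_
          refine (ENNReal.div_le_div_right (hZint n hn J hJ) _).trans ?_
          rw [← ENNReal.ofReal_div_of_pos (Real.exp_pos _), ← Real.exp_sub]
          refine le_of_eq ?_
          congr 2
          ring
      _ = ENNReal.ofReal ((F n).card * Real.exp (-(c / 2) * n)) := by
          rw [Finset.sum_const, nsmul_eq_mul, ENNReal.ofReal_mul (Nat.cast_nonneg _),
            ENNReal.ofReal_natCast]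
      _ ≤ _ := by
          refine ENNReal.ofReal_le_ofReal ?_
          rw [← mul_assoc, ← mul_pow]
          refine mul_le_mul_of_nonneg_right ?_ (Real.exp_nonneg _)
          have h1 : ((F n).card : ℝ) ≤ ((n * N + 1 : ℕ) : ℝ) ^ p := by exact_mod_cast hFcard n
          refine h1.trans (pow_le_pow_left₀ (Nat.cast_nonneg _) ?_ _)
          have : (1 : ℝ) ≤ n := by exact_mod_cast hn1
          push_cast
          nlinarith
  have hsummable : Summable fun n : ℕ =>
      ((N : ℝ) + 1) ^ p * ((n : ℝ) ^ p * Real.exp (-(c / 2) * n)) :=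
    (Real.summable_pow_mul_exp_neg_nat_mul p (by positivity)).mul_left _
  have htsum : ∑' n, P (E (n + (n₀ + 1))) ≠ ⊤ := by
    have h := (summable_nat_add_iff (n₀ + 1)).2 hsummable
    refine ne_top_of_le_ne_top h.tsum_ofReal_ne_top (ENNReal.tsum_le_tsum fun n => ?_)
    exact hE _ (by omega) (by omega)
  filter_upwards [ae_eventually_notMem htsum] with ω hω
  obtain ⟨m, hm⟩ := eventually_atTop.1 hω
  refine eventually_atTop.2 ⟨m + (n₀ + 1), fun n hn v hv => ?_⟩
  have hnot : ω ∉ E n := by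
    have := hm (n - (n₀ + 1)) (by omega)
    rwa [Nat.sub_add_cancel (by omega)] at this
  let J : Fin n → Fin N := fun i => κ i (T i v)
  have hJ : J ∈ F n := Finset.mem_filter.2 ⟨Finset.mem_univ _, v, hv, fun i => rfl⟩
  have hlt : Z n J ω < ENNReal.ofReal (Real.exp (-(c / 4 * n))) := by
    by_contra! h
    exact hnot (Set.mem_biUnion (show J ∈ (F n : Set _) from hJ) h)
  have hle : ENNReal.ofReal (Real.exp
      (∑ i ∈ Finset.range n, s i * llr b (θ₀ i) (T i v) (y i ω))) ≤ Z n J ω := by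
    rw [Finset.sum_range, Real.exp_sum, ENNReal.ofReal_prod_of_nonneg fun i _ => Real.exp_nonneg _]
    refine Finset.prod_le_prod' fun i _ => ?_
    exact le_iSup₂_of_le (T i v) ⟨hTI i v hv, rfl⟩ le_rfl
  exact Real.exp_lt_exp.1 ((ENNReal.ofReal_lt_ofReal_iff (Real.exp_pos _)).1 (hle.trans_lt hlt))

/-! ### Separation of linear predictors through the information matrix -/

theorem dotProduct_fisherInfo_mulVec {p : ℕ} (b u : ℝ → ℝ) (w : ℕ → ℝ) (x : ℕ → Fin p → ℝ)
    (β₀ d : Fin p → ℝ) (n : ℕ) :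
    d ⬝ᵥ (fisherInfo b u w x β₀ n).mulVec d = ∑ i ∈ Finset.range n,
      (w i * (deriv u (x i ⬝ᵥ β₀)) ^ 2 * deriv (deriv b) (u (x i ⬝ᵥ β₀))) * (x i ⬝ᵥ d) ^ 2 := by
  unfold fisherInfo
  rw [Matrix.sum_mulVec, dotProduct_sum]
  refine Finset.sum_congr rfl fun i _ => ?_
  rw [Matrix.smul_mulVec, dotProduct_smul, Matrix.vecMulVec_mulVec, smul_eq_mul]
  simp only [op_smul_eq_smul, dotProduct_smul, smul_eq_mul]
  rw [dotProduct_comm d (x i)]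
  ring

theorem dotProduct_sq_le_of_abs_le {p : ℕ} {x d : Fin p → ℝ} {L : ℝ} (hx : ∀ j, |x j| ≤ L) :
    (x ⬝ᵥ d) ^ 2 ≤ p * L ^ 2 * (d ⬝ᵥ d) := by
  have h1 : (x ⬝ᵥ d) ^ 2 ≤ (∑ j, x j ^ 2) * ∑ j, d j ^ 2 :=
    Finset.sum_mul_sq_le_sq_mul_sq _ _ _
  have h2 : ∑ j, x j ^ 2 ≤ p * L ^ 2 := by
    have : ∑ j, x j ^ 2 ≤ ∑ _j : Fin p, L ^ 2 :=
      Finset.sum_le_sum fun j _ => sq_le_sq' (abs_le.1 (hx j)).1 (abs_le.1 (hx j)).2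
    simpa using this
  have h3 : ∑ j, d j ^ 2 = d ⬝ᵥ d := by
    simp only [dotProduct, sq]
  rw [h3] at h1
  refine h1.trans (mul_le_mul_of_nonneg_right h2 ?_)
  rw [← h3]
  positivity

/-- Under the regularity conditions, a coefficient vector away from the truth changes the linear
predictor by a fixed amount for a positive weighted proportion of the observations. -/
theorem exists_weight_far_ge {p : ℕ} {b u : ℝ → ℝ} {w : ℕ → ℝ} {x : ℕ → Fin p → ℝ}
    {B : Set (Fin p → ℝ)} {β₀ : Fin p → ℝ} (hβ₀ : β₀ ∈ B) (hw_pos : ∀ k, 0 < w k)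
    (hH2 : BoundedDesign x) (hH3 : ParamSpaceCondition b u x B)
    (hH4 : RestrictedEigenvalueCondition b u w x β₀) {r : ℝ} (hr : 0 < r) :
    ∃ δ > 0, ∃ c > 0, ∀ᶠ n : ℕ in atTop, ∀ β : Fin p → ℝ, r ≤ (β - β₀) ⬝ᵥ (β - β₀) →
      c * n ≤ ∑ i ∈ Finset.range n, if δ ≤ |x i ⬝ᵥ β - x i ⬝ᵥ β₀| then w i else 0 := by
  obtain ⟨L, hL, hx⟩ := hH2
  obtain ⟨-, ⟨U, hU⟩, ⟨M, hM⟩⟩ := hH3 β₀ hβ₀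
  obtain ⟨⟨W, hW, hwW⟩, cl, hcl, cu, -, hev⟩ := hH4
  set A : ℝ := U ^ 2 * |M| + 1 with hA
  have hA0 : 0 < A := by positivity
  set K : ℝ := p * L ^ 2 + 1 with hK
  have hK0 : 0 < K := by positivity
  have ha : ∀ i, (deriv u (x i ⬝ᵥ β₀)) ^ 2 * deriv (deriv b) (u (x i ⬝ᵥ β₀)) ≤ A := by
    intro i
    have h1 : |deriv u (x i ⬝ᵥ β₀)| ≤ U := hU (Set.mem_range_self i)
    have h2 : deriv (deriv b) (u (x i ⬝ᵥ β₀)) ≤ M := hM (Set.mem_range_self i)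
    have h3 : (deriv u (x i ⬝ᵥ β₀)) ^ 2 ≤ U ^ 2 := sq_le_sq' (abs_le.1 h1).1 (abs_le.1 h1).2
    calc _ ≤ (deriv u (x i ⬝ᵥ β₀)) ^ 2 * |M| :=
          mul_le_mul_of_nonneg_left (h2.trans (le_abs_self M)) (sq_nonneg _)
      _ ≤ U ^ 2 * |M| := mul_le_mul_of_nonneg_right h3 (abs_nonneg M)
      _ ≤ A := by rw [hA]; linarith
  -- Chosen so that each observation closer than `δ` contributes at most `cl * r / 2`, in all at
  -- most half of the lower bound `cl * n * E`. The far observations carry the rest, at most `A * K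
  -- * E` per unit of weight; `E` cancels, so the bound holds for arbitrarily distant β.
  set δ : ℝ := √(cl * r / (2 * W * A)) with hδ
  have hδ2 : W * A * δ ^ 2 = cl * r / 2 := by
    rw [hδ, Real.sq_sqrt (by positivity)]
    field_simp
  have hδ0 : 0 < δ := Real.sqrt_pos.2 (by positivity)
  refine ⟨δ, hδ0, cl / (2 * A * K), by positivity, ?_⟩
  filter_upwards [hev] with n hn β hβ
  set d := β - β₀ with hd
  set E := d ⬝ᵥ d with hE
  have hE0 : 0 < E := hr.trans_le hβ
  have hquad : cl * n * E ≤ ∑ i ∈ Finset.range n,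
      (w i * (deriv u (x i ⬝ᵥ β₀)) ^ 2 * deriv (deriv b) (u (x i ⬝ᵥ β₀))) * (x i ⬝ᵥ d) ^ 2 := by
    have h := hn.1.dotProduct_mulVec_nonneg d
    rw [Matrix.sub_mulVec, dotProduct_sub, star_trivial, dotProduct_fisherInfo_mulVec,
      Matrix.smul_mulVec, Matrix.one_mulVec, dotProduct_smul, smul_eq_mul] at h
    linarith
  have hterm : ∀ i, (w i * (deriv u (x i ⬝ᵥ β₀)) ^ 2 * deriv (deriv b) (u (x i ⬝ᵥ β₀))) *
      (x i ⬝ᵥ d) ^ 2 ≤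
      cl * r / 2 + A * K * E * (if δ ≤ |x i ⬝ᵥ β - x i ⬝ᵥ β₀| then w i else 0) := by
    intro i
    have hxd : x i ⬝ᵥ β - x i ⬝ᵥ β₀ = x i ⬝ᵥ d := by rw [hd, dotProduct_sub]
    have hwi := hw_pos i
    have h1 : (w i * (deriv u (x i ⬝ᵥ β₀)) ^ 2 * deriv (deriv b) (u (x i ⬝ᵥ β₀))) *
        (x i ⬝ᵥ d) ^ 2 ≤ w i * A * (x i ⬝ᵥ d) ^ 2 := by
      rw [mul_assoc (w i)]
      exact mul_le_mul_of_nonneg_right (mul_le_mul_of_nonneg_left (ha i) hwi.le) (sq_nonneg _)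
    rw [hxd]
    split_ifs with hfar
    · have h2 : (x i ⬝ᵥ d) ^ 2 ≤ K * E :=
        (dotProduct_sq_le_of_abs_le (hx i)).trans
          (mul_le_mul_of_nonneg_right (by rw [hK]; linarith) hE0.le)
      have h3 := mul_le_mul_of_nonneg_left h2 (mul_pos hwi hA0).le
      have h4 : 0 < cl * r / 2 := by positivity
      linarith
    · have h2 : (x i ⬝ᵥ d) ^ 2 ≤ δ ^ 2 := by
        rw [← sq_abs]
        exact pow_le_pow_left₀ (abs_nonneg _) (not_le.1 hfar).le 2
      calc _ ≤ w i * A * (x i ⬝ᵥ d) ^ 2 := h1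
        _ ≤ W * A * δ ^ 2 := mul_le_mul (mul_le_mul_of_nonneg_right (hwW i) hA0.le) h2
            (sq_nonneg _) (by positivity)
        _ = _ := by rw [hδ2]; ring
  have hsum := hquad.trans (Finset.sum_le_sum fun i _ => hterm i)
  rw [Finset.sum_add_distrib, ← Finset.mul_sum, Finset.sum_const, Finset.card_range,
    nsmul_eq_mul] at hsum
  set F := ∑ i ∈ Finset.range n, if δ ≤ |x i ⬝ᵥ β - x i ⬝ᵥ β₀| then w i else 0
  have hhalf : n * (cl * r / 2) ≤ n * (cl * E / 2) := by gcongr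
  have hmain : cl * n * E ≤ 2 * (A * K * F) * E := by nlinarith
  have hmain' : cl * n ≤ 2 * (A * K * F) := le_of_mul_le_mul_right hmain hE0
  rw [div_mul_eq_mul_div, div_le_iff₀ (by positivity)]
  linarith

/-! ### Uniform lower bounds for the midpoint gap -/

theorem midGap_comm (b : ℝ → ℝ) (s t : ℝ) : midGap b s t = midGap b t s := by
  unfold midGap
  rw [add_comm s t, add_comm (b s)]

/-- Both `(s + t) / 2` and `t'` lie between `a = (s + t') / 2` and `t`. The convexity inequality at
the first plus half of that at the second is the claim. -/
theorem midGap_le_of_mem_segment {b : ℝ → ℝ} {I : Set ℝ} (hb : ConvexOn ℝ I b) {s t t' : ℝ}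
    (hs : s ∈ I) (ht : t ∈ I) (ht' : t' ∈ segment ℝ s t) : midGap b s t' ≤ midGap b s t := by
  have ht'I : t' ∈ I := hb.1.segment_subset hs ht ht'
  obtain ⟨q, m, hq, hm, hqm, rfl⟩ := ht'
  obtain rfl : q = 1 - m := by linarith
  simp only [smul_eq_mul] at ht'I ⊢
  set t' := (1 - m) * s + m * t with ht'def
  have h2m : 0 < 2 - m := by linarith
  have haI : (s + t') / 2 ∈ I := by
    have h := hb.1 hs ht'I (show (0 : ℝ) ≤ 1 / 2 by norm_num) (show (0 : ℝ) ≤ 1 / 2 by norm_num)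
      (by norm_num)
    simp only [smul_eq_mul] at h
    have e : (s + t') / 2 = 1 / 2 * s + 1 / 2 * t' := by ring
    rwa [e]
  set a := (s + t') / 2 with hadef
  have h1 := hb.2 haI ht (show 0 ≤ 1 / (2 - m) by positivity)
    (show 0 ≤ (1 - m) / (2 - m) from div_nonneg hq h2m.le) (by field_simp; ring)
  have h2 := hb.2 haI ht (show 0 ≤ (2 - 2 * m) / (2 - m) from div_nonneg (by linarith) h2m.le)
    (show 0 ≤ m / (2 - m) from div_nonneg hm h2m.le) (by field_simp; ring)
  simp only [smul_eq_mul] at h1 h2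
  have e1 : 1 / (2 - m) * a + (1 - m) / (2 - m) * t = (s + t) / 2 := by
    rw [hadef, ht'def]; field_simp; ring
  have e2 : (2 - 2 * m) / (2 - m) * a + m / (2 - m) * t = t' := by
    rw [hadef, ht'def]; field_simp; ring
  rw [e1] at h1
  rw [e2] at h2
  have e3 : (1 / (2 - m) * b a + (1 - m) / (2 - m) * b t) +
      ((2 - 2 * m) / (2 - m) * b a + m / (2 - m) * b t) / 2 = b a + b t / 2 := by
    field_simp; ring
  unfold midGap
  linarith

theorem midGap_pos {b : ℝ → ℝ} {J : Set ℝ} (hb : StrictConvexOn ℝ J b) {s t : ℝ} (hs : s ∈ J)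
    (ht : t ∈ J) (hst : s ≠ t) : 0 < midGap b s t := by
  have h := hb.2 hs ht hst (show (0 : ℝ) < 1 / 2 by norm_num) (show (0 : ℝ) < 1 / 2 by norm_num)
    (by norm_num)
  simp only [smul_eq_mul] at h
  have e : (1 / 2 : ℝ) * s + 1 / 2 * t = (s + t) / 2 := by ring
  rw [e] at h
  unfold midGap
  linarith

theorem exists_pos_forall_le {ι : Type*} (F : Finset ι) (f : ι → ℝ) (hf : ∀ i ∈ F, 0 < f i) :
    ∃ κ > 0, ∀ i ∈ F, κ ≤ f i := by
  rcases F.eq_empty_or_nonempty with rfl | hF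
  · exact ⟨1, one_pos, by simp⟩
  · obtain ⟨i, hi, hmin⟩ := F.exists_min_image f hF
    exact ⟨f i, hf i hi, hmin⟩

/-- Linear predictors at least `δ` apart, one of them in a bounded set, are uniformly separated,
even near the ends of the interval `D`. -/
theorem exists_le_midGap {b u : ℝ → ℝ} {D I : Set ℝ} (hD : D.OrdConnected)
    (hb : ConvexOn ℝ I b) (huI : ∀ t ∈ D, u t ∈ I) (hbs : StrictConvexOn ℝ (u '' D) b)
    (hu : MonotoneOn u D ∨ AntitoneOn u D) (huinj : Set.InjOn u D) {δ : ℝ} (hδ : 0 < δ) (R : ℝ) :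
    ∃ κ > 0, ∀ t ∈ D, ∀ t' ∈ D, |t| ≤ R → δ ≤ |t' - t| → κ ≤ midGap b (u t) (u t') := by
  classical
  -- On a grid of mesh `δ / 2`, any interval of length `δ` contains a whole grid cell, and
  -- boundedness leaves finitely many cells. Only those with endpoints in `D` are kept, so no
  -- compactness at the ends of `D` is needed.
  obtain ⟨M, hM⟩ := exists_nat_ge ((R + δ) / (δ / 2) + 1)
  let g : ℤ → ℝ := fun k => k * (δ / 2)
  let F : Finset ℤ := (Finset.Icc (-(M : ℤ)) M).filter fun k => g k ∈ D ∧ g (k + 1) ∈ D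
  have hgt : ∀ k, g k < g (k + 1) := fun k => by
    simp only [g]; push_cast; linarith
  obtain ⟨κ, hκ, hκF⟩ := exists_pos_forall_le F (fun k => midGap b (u (g k)) (u (g (k + 1))))
    fun k hk => by
      obtain ⟨-, h1, h2⟩ := Finset.mem_filter.1 hk
      exact midGap_pos hbs (Set.mem_image_of_mem u h1) (Set.mem_image_of_mem u h2)
        fun h => (hgt k).ne (huinj h1 h2 h)
  have hseg : ∀ a ∈ D, ∀ c ∈ D, ∀ t, a ≤ t → t ≤ c → u t ∈ segment ℝ (u a) (u c) := by
    intro a ha c hc t hat htc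
    have ht := hD.out ha hc ⟨hat, htc⟩
    rw [segment_eq_uIcc, Set.mem_uIcc]
    rcases hu with hu | hu
    · exact Or.inl ⟨hu ha ht hat, hu ht hc htc⟩
    · exact Or.inr ⟨hu ht hc htc, hu ha ht hat⟩
  have key : ∀ a, |a| ≤ R + δ → ∀ s ∈ D, ∀ t ∈ D, s ≤ a → a + δ ≤ t →
      κ ≤ midGap b (u s) (u t) := by
    intro a haR s hs t ht hsa hat
    set k := ⌈a / (δ / 2)⌉ with hk
    have hk1 : a ≤ g k := by
      have := Int.le_ceil (a / (δ / 2))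
      rwa [div_le_iff₀ (by positivity)] at this
    have hk2 : (k : ℝ) < a / (δ / 2) + 1 := Int.ceil_lt_add_one _
    have hk3 : g (k + 1) ≤ a + δ := by
      have h : a / (δ / 2) * (δ / 2) = a := div_mul_cancel₀ _ (by positivity)
      simp only [g]
      push_cast
      nlinarith
    have hg1 : g k ∈ D := hD.out hs ht ⟨hsa.trans hk1, by linarith [hgt k]⟩
    have hg2 : g (k + 1) ∈ D := hD.out hs ht ⟨by linarith [hgt k], hk3.trans hat⟩
    have hkF : k ∈ F := by
      have hup : a / (δ / 2) ≤ (R + δ) / (δ / 2) :=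
        div_le_div_of_nonneg_right (abs_le.1 haR).2 (by positivity)
      have hlow : -((R + δ) / (δ / 2)) ≤ a / (δ / 2) := by
        rw [← neg_div]
        exact div_le_div_of_nonneg_right (abs_le.1 haR).1 (by positivity)
      have hk4 : a / (δ / 2) ≤ k := Int.le_ceil _
      refine Finset.mem_filter.2 ⟨Finset.mem_Icc.2 ⟨?_, ?_⟩, hg1, hg2⟩
      · have : (-(M : ℤ) : ℝ) ≤ k := by push_cast; linarith
        exact_mod_cast this
      · have : (k : ℝ) ≤ M := by linarith
        exact_mod_cast this
    -- The pair is shrunk to the grid cell one endpoint at a time.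
    have h1 : midGap b (u s) (u (g (k + 1))) ≤ midGap b (u s) (u t) :=
      midGap_le_of_mem_segment hb (huI s hs) (huI t ht)
        (hseg s hs t ht _ (by linarith [hgt k]) (hk3.trans hat))
    have h2 : midGap b (u (g (k + 1))) (u (g k)) ≤ midGap b (u (g (k + 1))) (u s) := by
      refine midGap_le_of_mem_segment hb (huI _ hg2) (huI s hs) ?_
      rw [segment_symm]
      exact hseg s hs _ hg2 _ (hsa.trans hk1) (hgt k).le
    rw [midGap_comm, midGap_comm b _ (u s)] at h2
    exact (hκF k hkF).trans (h2.trans h1)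
  refine ⟨κ, hκ, fun t ht t' ht' htR hfar => ?_⟩
  obtain ⟨h1, h2⟩ := abs_le.1 htR
  rcases le_abs.1 hfar with h | h
  · exact key t (htR.trans (by linarith)) t ht t' ht' le_rfl (by linarith)
  · rw [midGap_comm]
    -- Here `t - δ` may have absolute value above `R`, which is why `key` allows `R + δ`.
    exact key (t - δ) (abs_le.2 ⟨by linarith, by linarith⟩) t' ht' t ht (by linarith) (by linarith)

end GLM

/-- Witnesses against both alternatives would lie in one compact interval inside `D`, where a
continuous injection is strictly monotone. -/
theorem ContinuousOn.monotoneOn_or_antitoneOn_of_injOn {u : ℝ → ℝ} {D : Set ℝ}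
    (hD : D.OrdConnected) (hu : ContinuousOn u D) (hinj : Set.InjOn u D) :
    MonotoneOn u D ∨ AntitoneOn u D := by
  by_contra! hcon
  obtain ⟨h1, h2⟩ := hcon
  simp only [MonotoneOn, AntitoneOn, not_forall, not_le] at h1 h2
  obtain ⟨a, ha, c, hc, hac, hlt⟩ := h1
  obtain ⟨a', ha', c', hc', hac', hlt'⟩ := h2
  have hm : min a a' ∈ D := by rcases min_choice a a' with h | h <;> rwa [h]
  have hM : max c c' ∈ D := by rcases max_choice c c' with h | h <;> rwa [h]
  have hsub : Set.Icc (min a a') (max c c') ⊆ D := hD.out hm hM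
  have hac1 : min a a' ≤ max c c' := (min_le_left _ _).trans (hac.trans (le_max_left _ _))
  have ia : a ∈ Set.Icc (min a a') (max c c') := ⟨min_le_left _ _, hac.trans (le_max_left _ _)⟩
  have ic : c ∈ Set.Icc (min a a') (max c c') := ⟨(min_le_left _ _).trans hac, le_max_left _ _⟩
  have ia' : a' ∈ Set.Icc (min a a') (max c c') :=
    ⟨min_le_right _ _, hac'.trans (le_max_right _ _)⟩
  have ic' : c' ∈ Set.Icc (min a a') (max c c') :=
    ⟨(min_le_right _ _).trans hac', le_max_right _ _⟩
  rcases ContinuousOn.strictMonoOn_of_injOn_Icc' hac1 (hu.mono hsub) (hinj.mono hsub) with h | h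
  · exact absurd (h.monotoneOn ia ic hac) (not_le.2 hlt)
  · exact absurd (h.antitoneOn ia' ic' hac') (not_le.2 hlt')

/-! ### Analytic properties of the exponential family -/

namespace GLM

/-- The carrier measure `c(y) μ(dy)` of the exponential family. -/
noncomputable def carrier (μ : Measure ℝ) (c : ℝ → ℝ) : Measure ℝ :=
  μ.withDensity fun y => ((c y).toNNReal : ENNReal)

theorem natParamSpace_eq_integrableExpSet (μ : Measure ℝ) {c : ℝ → ℝ} (hc : Measurable c)
    (hc_pos : ∀ t, 0 < c t) : natParamSpace μ c = integrableExpSet id (carrier μ c) := by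
  ext η
  simp only [natParamSpace, integrableExpSet, carrier, Set.mem_ofPred_eq]
  rw [integrable_withDensity_iff_integrable_smul hc.real_toNNReal]
  refine integrable_congr (ae_of_all _ fun y => ?_)
  simp [NNReal.smul_def, (hc_pos y).le, mul_comm]

theorem logPartition_eq_cgf (μ : Measure ℝ) {c : ℝ → ℝ} (hc : Measurable c)
    (hc_pos : ∀ t, 0 < c t) : logPartition μ c = cgf id (carrier μ c) := by
  funext η
  simp only [logPartition, cgf, mgf, carrier]
  rw [integral_withDensity_eq_integral_smul hc.real_toNNReal]
  congr 1
  refine integral_congr_ae (ae_of_all _ fun y => ?_)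
  simp [NNReal.smul_def, (hc_pos y).le, mul_comm]

/-- The likelihood ratios in the exponential family integrate to one. -/
theorem lintegral_exp_llr_expFamilyLaw {μ : Measure ℝ} (hμ : μ ≠ 0) {c : ℝ → ℝ}
    (hc : Measurable c) (hc_pos : ∀ t, 0 < c t) {θ : ℝ} (hθ : θ ∈ natParamSpace μ c) (θ₀ : ℝ) :
    ∫⁻ y, ENNReal.ofReal (Real.exp (llr (logPartition μ c) θ₀ θ y)) ∂(expFamilyLaw μ c θ₀) = 1 := by
  set b := logPartition μ c with hb
  have hθ' : Integrable (fun y => c y * Real.exp (y * θ)) μ := hθ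
  have hpos : 0 < ∫ y, c y * Real.exp (y * θ) ∂μ := by
    rw [integral_pos_iff_support_of_nonneg
      (fun y => mul_nonneg (hc_pos y).le (Real.exp_nonneg _)) hθ']
    have : Function.support (fun y => c y * Real.exp (y * θ)) = Set.univ :=
      Set.eq_univ_of_forall fun y => (mul_pos (hc_pos y) (Real.exp_pos _)).ne'
    rw [this]
    exact Measure.measure_univ_pos.2 hμ
  have hexp : Real.exp (b θ) = ∫ y, c y * Real.exp (y * θ) ∂μ := by
    rw [hb, logPartition, Real.exp_log hpos]
  unfold expFamilyLaw
  have hllr := (continuous_llr b θ₀ θ).measurable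
  rw [lintegral_withDensity_eq_lintegral_mul _ (by fun_prop) (by fun_prop)]
  have hpt : ∀ y, ((fun y => ENNReal.ofReal (c y * Real.exp (y * θ₀ - b θ₀))) *
      fun y => ENNReal.ofReal (Real.exp (llr b θ₀ θ y))) y =
      ENNReal.ofReal (Real.exp (-b θ) * (c y * Real.exp (y * θ))) := by
    intro y
    rw [Pi.mul_apply, ← ENNReal.ofReal_mul (mul_nonneg (hc_pos y).le (Real.exp_nonneg _))]
    congr 1
    rw [mul_assoc, ← Real.exp_add, mul_left_comm, ← Real.exp_add]
    congr 2
    unfold llr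
    ring
  rw [lintegral_congr hpt, ← ofReal_integral_eq_lintegral_ofReal (hθ'.const_mul _)
    (ae_of_all _ fun y =>
      mul_nonneg (Real.exp_nonneg _) (mul_nonneg (hc_pos y).le (Real.exp_nonneg _))),
    integral_const_mul, ← hexp, ← Real.exp_add]
  simp

theorem convex_interior_natParamSpace (μ : Measure ℝ) {c : ℝ → ℝ} (hc : Measurable c)
    (hc_pos : ∀ t, 0 < c t) : Convex ℝ (interior (natParamSpace μ c)) := by
  rw [natParamSpace_eq_integrableExpSet μ hc hc_pos]
  exact convex_integrableExpSet.interior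

theorem analyticOnNhd_logPartition (μ : Measure ℝ) {c : ℝ → ℝ} (hc : Measurable c)
    (hc_pos : ∀ t, 0 < c t) :
    AnalyticOnNhd ℝ (logPartition μ c) (interior (natParamSpace μ c)) := by
  rw [natParamSpace_eq_integrableExpSet μ hc hc_pos, logPartition_eq_cgf μ hc hc_pos]
  exact analyticOnNhd_cgf

/-- The second derivative is the variance of a tilted law, hence non-negative. -/
theorem monotoneOn_deriv_logPartition (μ : Measure ℝ) {c : ℝ → ℝ} (hc : Measurable c)
    (hc_pos : ∀ t, 0 < c t) :
    MonotoneOn (deriv (logPartition μ c)) (interior (natParamSpace μ c)) := by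
  have han := (analyticOnNhd_logPartition μ hc hc_pos).deriv
  refine monotoneOn_of_deriv_nonneg (convex_interior_natParamSpace μ hc hc_pos) han.continuousOn
    (han.differentiableOn.mono interior_subset) fun v hv => ?_
  rw [interior_interior, natParamSpace_eq_integrableExpSet μ hc hc_pos] at hv
  have h := iteratedDeriv_two_cgf_eq_integral hv
  rw [iteratedDeriv_succ, iteratedDeriv_one, ← logPartition_eq_cgf μ hc hc_pos] at h
  rw [h]
  exact div_nonneg (integral_nonneg fun y => mul_nonneg (sq_nonneg _) (Real.exp_nonneg _))
    mgf_nonneg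

theorem convexOn_logPartition (μ : Measure ℝ) {c : ℝ → ℝ} (hc : Measurable c)
    (hc_pos : ∀ t, 0 < c t) :
    ConvexOn ℝ (interior (natParamSpace μ c)) (logPartition μ c) := by
  have han := analyticOnNhd_logPartition μ hc hc_pos
  refine MonotoneOn.convexOn_of_deriv (convex_interior_natParamSpace μ hc hc_pos)
    han.continuousOn (han.differentiableOn.mono interior_subset) ?_
  exact (monotoneOn_deriv_logPartition μ hc hc_pos).mono interior_subset

/-- The log-partition function is strictly convex on a set where its derivative is injective. -/
theorem strictConvexOn_logPartition (μ : Measure ℝ) {c : ℝ → ℝ} (hc : Measurable c)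
    (hc_pos : ∀ t, 0 < c t) {J : Set ℝ} (hJ : Convex ℝ J)
    (hJI : J ⊆ interior (natParamSpace μ c)) (hinj : Set.InjOn (deriv (logPartition μ c)) J) :
    StrictConvexOn ℝ J (logPartition μ c) := by
  refine StrictMonoOn.strictConvexOn_of_deriv hJ
    ((analyticOnNhd_logPartition μ hc hc_pos).continuousOn.mono hJI) ?_
  exact (((monotoneOn_deriv_logPartition μ hc hc_pos).mono hJI).strictMonoOn_of_injOn hinj).mono
    interior_subset

theorem subDesign_dotProduct {p : ℕ} (x : ℕ → Fin p → ℝ) (α : Finset (Fin p)) (i : ℕ)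
    (v : α → ℝ) : subDesign x α i ⬝ᵥ v = x i ⬝ᵥ augment α v := by
  classical
  simp only [dotProduct, subDesign, augment]
  rw [← Finset.sum_subset (Finset.subset_univ α) fun j _ hj => by simp [hj],
    ← Finset.sum_coe_sort α]
  exact Finset.sum_congr rfl fun j _ => by simp

theorem logLik_subDesign {p : ℕ} (b u : ℝ → ℝ) (w : ℕ → ℝ) (x : ℕ → Fin p → ℝ)
    (α : Finset (Fin p)) (n : ℕ) (y : ℕ → ℝ) (v : α → ℝ) :
    logLik b u w (subDesign x α) n y v = logLik b u w x n y (augment α v) := by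
  simp only [logLik, subDesign_dotProduct]

/-- A coefficient vector of an incorrect sub-model stays away from the truth. -/
theorem IsIncorrectModel.exists_le_dotProduct_sub {p : ℕ} {β₀ : Fin p → ℝ} {α : Finset (Fin p)}
    (hα : IsIncorrectModel β₀ α) :
    ∃ r > 0, ∀ v : α → ℝ, r ≤ (augment α v - β₀) ⬝ᵥ (augment α v - β₀) := by
  obtain ⟨j, hj, hβj⟩ := hα
  refine ⟨β₀ j * β₀ j, mul_self_pos.2 hβj, fun v => ?_⟩
  have h := Finset.single_le_sum (f := fun k => (augment α v - β₀) k * (augment α v - β₀) k)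
    (fun k _ => mul_self_nonneg _) (Finset.mem_univ j)
  refine le_trans (le_of_eq ?_) h
  simp [augment, hj]

theorem div_one_add_le_one_sub_exp_neg {z : ℝ} (hz : 0 ≤ z) : z / (1 + z) ≤ 1 - Real.exp (-z) := by
  have h : Real.exp (-z) ≤ 1 / (1 + z) := by
    rw [Real.exp_neg, ← one_div]
    exact one_div_le_one_div_of_le (by linarith) (by linarith [Real.add_one_le_exp z])
  have e : z / (1 + z) = 1 - 1 / (1 + z) := by field_simp; ring
  linarith

end GLM

/-! ### The main theorem -/

theorem theorem3
    {Ω : Type*} [MeasurableSpace Ω] (P : Measure Ω) [IsProbabilityMeasure P]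
    -- the exponential family
    (μ : Measure ℝ) (c : ℝ → ℝ) (hc_meas : Measurable c) (hc_pos : ∀ t, 0 < c t)
    (b : ℝ → ℝ) (hb : b = GLM.logPartition μ c)
    -- the relation function `u`, on an open interval `D` of linear predictors, and the link `g`
    (D : Set ℝ) (hD_open : IsOpen D) (hD_interval : D.OrdConnected)
    (u g : ℝ → ℝ) (hu_smooth : ContDiffOn ℝ 2 u D)
    (hu_mem : ∀ t ∈ D, u t ∈ interior (GLM.natParamSpace μ c))
    (hg : ∀ t ∈ D, g (deriv b (u t)) = t)
    -- fixed covariates, parameter space, true parameter, weights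
    {p : ℕ} (x : ℕ → Fin p → ℝ) (B : Set (Fin p → ℝ))
    (hB : ∀ β ∈ B, ∀ k, x k ⬝ᵥ β ∈ D)
    (β₀ : Fin p → ℝ) (hβ₀ : β₀ ∈ B)
    (w : ℕ → ℝ) (hw_pos : ∀ k, 0 < w k)
    -- independent responses
    (y : ℕ → Ω → ℝ) (hy_indep : iIndepFun y P)
    (hy_law : ∀ k, HasLaw (y k) (GLM.expFamilyLaw μ c (u (x k ⬝ᵥ β₀))) P)
    -- the regularity conditions
    (hH1 : GLM.InfoEigenvalueCondition b u w x β₀)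
    (hH2 : GLM.BoundedDesign x)
    (hH3 : GLM.ParamSpaceCondition b u x B)
    (hH4 : GLM.RestrictedEigenvalueCondition b u w x β₀)
    -- an incorrect sub-model and its maximum likelihood estimates
    (α : Finset (Fin p)) (hα : GLM.IsIncorrectModel β₀ α)
    (βhat : ℕ → Ω → (α → ℝ))
    (hβhat : ∀ᵐ ω ∂P, ∀ᶠ n : ℕ in atTop,
      GLM.IsSubmodelMLE b u w x B α n (fun k => y k ω) (βhat n ω)) :
    ∀ᵐ ω ∂P,
      limsup (fun n : ℕ =>
        (((n : ℝ)⁻¹ *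
          (GLM.logLik b u w (GLM.subDesign x α) n (fun k => y k ω) (βhat n ω)
            - GLM.logLik b u w x n (fun k => y k ω) β₀) : ℝ) : EReal)) atTop < 0 := by
  subst hb
  -- The zero measure has to be excluded: its family members have no mass, while `y 0` has a
  -- probability law.
  set b := GLM.logPartition μ c with hb
  set I := interior (GLM.natParamSpace μ c) with hI
  have hμ : μ ≠ 0 := by
    rintro rfl
    have h := (hy_law 0).map_eq
    simp only [GLM.expFamilyLaw, withDensity_zero_left] at h
    have h1 : (P.map (y 0)) Set.univ = 1 := by
      rw [Measure.map_apply_of_aemeasurable (hy_law 0).aemeasurable MeasurableSet.univ]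
      simp
    simp [h] at h1
  have hconv : ConvexOn ℝ I b := GLM.convexOn_logPartition μ hc_meas hc_pos
  have hcont : ContinuousOn u D := hu_smooth.continuousOn
  -- The link inverts `t ↦ b' (u t)`. So `u` is injective, and `b'` is injective on the image of
  -- `u`, which rules out degenerate families.
  have hinj' : Set.InjOn (fun t => deriv b (u t)) D := fun s hs t ht h => by
    rw [← hg s hs, ← hg t ht]
    exact congrArg g h
  have hinj : Set.InjOn u D := fun s hs t ht h => hinj' hs ht (congrArg (deriv b) h)
  have hmono := hcont.monotoneOn_or_antitoneOn_of_injOn hD_interval hinj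
  have hstrict : StrictConvexOn ℝ (u '' D) b := by
    refine GLM.strictConvexOn_logPartition μ hc_meas hc_pos ?_ ?_ ?_
    · exact (hD_interval.isPreconnected.image u hcont).convex
    · rintro _ ⟨t, ht, rfl⟩
      exact hu_mem t ht
    · rintro _ ⟨s, hs, rfl⟩ _ ⟨t, ht, rfl⟩ h
      exact congrArg u (hinj' hs ht h)
  obtain ⟨r, hr, hrα⟩ := hα.exists_le_dotProduct_sub
  obtain ⟨δ, hδ, c₁, hc₁, hfar⟩ := GLM.exists_weight_far_ge hβ₀ hw_pos hH2 hH3 hH4 hr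
  obtain ⟨L, hL, hx⟩ := hH2
  obtain ⟨⟨W, hW, hwW⟩, -⟩ := hH4
  -- The radius bounds all true linear predictors, by Cauchy–Schwarz and the bounded design.
  obtain ⟨κ, hκ, hgap⟩ := GLM.exists_le_midGap hD_interval hconv hu_mem hstrict hmono hinj hδ
    (√(p * L ^ 2 * (β₀ ⬝ᵥ β₀)))
  let V : Set (Fin p → ℝ) := {β | β ∈ B ∧ r ≤ (β - β₀) ⬝ᵥ (β - β₀)}
  -- With `z = w i * κ / W ≤ κ`, each far observation gives `1 - exp (-z) ≥ z / (1 + κ)`, which is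
  -- linear in its weight.
  set c₂ : ℝ := κ / (W * (1 + κ)) * c₁ with hc₂def
  have hc₂ : 0 < c₂ := by positivity
  have hs0 : ∀ i, 0 ≤ w i / (2 * W) := fun i => div_nonneg (hw_pos i).le (by positivity)
  have hs : ∀ i, w i / (2 * W) ≤ 1 / 2 := fun i => by
    rw [div_le_div_iff₀ (by positivity) two_pos]
    linarith [hwW i]
  have hsep : ∀ᶠ n : ℕ in atTop, ∀ v ∈ V, c₂ * n ≤ ∑ i ∈ Finset.range n,
      (1 - Real.exp (-(2 * (w i / (2 * W)) *
        GLM.midGap b (u (x i ⬝ᵥ β₀)) (u (x i ⬝ᵥ v))))) := by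
    filter_upwards [hfar] with n hn v hv
    have h1 := mul_le_mul_of_nonneg_left (hn v hv.2) (show 0 ≤ κ / (W * (1 + κ)) by positivity)
    rw [← mul_assoc, ← hc₂def, Finset.mul_sum] at h1
    refine h1.trans (Finset.sum_le_sum fun i _ => ?_)
    have hgap0 := GLM.midGap_nonneg hconv (hu_mem _ (hB β₀ hβ₀ i)) (hu_mem _ (hB v hv.1 i))
    split_ifs with hi
    · have hg1 := hgap _ (hB β₀ hβ₀ i) _ (hB v hv.1 i)
        (Real.abs_le_sqrt (GLM.dotProduct_sq_le_of_abs_le (hx i))) hi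
      set z := w i * κ / W with hz
      have hz0 : 0 ≤ z := div_nonneg (mul_nonneg (hw_pos i).le hκ.le) hW.le
      have hzκ : z ≤ κ := by
        rw [hz, div_le_iff₀ hW]
        nlinarith [hwW i]
      calc κ / (W * (1 + κ)) * w i = z / (1 + κ) := by rw [hz]; field_simp
        _ ≤ z / (1 + z) := div_le_div_of_nonneg_left hz0 (by linarith) (by linarith)
        _ ≤ 1 - Real.exp (-z) := GLM.div_one_add_le_one_sub_exp_neg hz0
        _ ≤ _ := by
          refine sub_le_sub_left (Real.exp_le_exp.2 (neg_le_neg ?_)) _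
          have e : 2 * (w i / (2 * W)) = w i / W := by field_simp
          rw [e, hz, mul_div_right_comm]
          exact mul_le_mul_of_nonneg_left hg1 (div_nonneg (hw_pos i).le hW.le)
    · rw [mul_zero, sub_nonneg, Real.exp_le_one_iff, neg_nonpos]
      exact mul_nonneg (mul_nonneg zero_le_two (hs0 i)) hgap0
  have hcore : ∀ᵐ ω ∂P, ∀ᶠ n : ℕ in atTop, ∀ v ∈ V, ∑ i ∈ Finset.range n,
      w i / (2 * W) * GLM.llr b (u (x i ⬝ᵥ β₀)) (u (x i ⬝ᵥ v)) (y i ω) < -(c₂ / 4 * n) := by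
    have hQ : ∀ i, ∀ θ ∈ I, ∫⁻ t, ENNReal.ofReal (Real.exp (GLM.llr b (u (x i ⬝ᵥ β₀)) θ t))
        ∂(GLM.expFamilyLaw μ c (u (x i ⬝ᵥ β₀))) = 1 := fun i θ hθ =>
      GLM.lintegral_exp_llr_expFamilyLaw hμ hc_meas hc_pos (interior_subset hθ) _
    have hTI : ∀ i, ∀ v ∈ V, u (x i ⬝ᵥ v) ∈ I := fun i v hv => hu_mem _ (hB v hv.1 i)
    have hθ₀ : ∀ i, u (x i ⬝ᵥ β₀) ∈ I := fun i => hu_mem _ (hB β₀ hβ₀ i)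
    rcases hmono with hmono | hanti
    · exact GLM.ae_eventually_forall_sum_llr_lt hconv hθ₀ hQ hy_indep hy_law hs0 hs x V
        (fun i v => u (x i ⬝ᵥ v)) hTI
        (fun i v hv v' hv' h => hmono.reflect_lt (hB v' hv'.1 i) (hB v hv.1 i) h) hc₂ hsep
    -- For decreasing `u` the cells are monotone in the functional `-x i`.
    · refine GLM.ae_eventually_forall_sum_llr_lt hconv hθ₀ hQ hy_indep hy_law hs0 hs
        (fun i => -x i) V (fun i v => u (x i ⬝ᵥ v)) hTI (fun i v hv v' hv' h => ?_) hc₂ hsep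
      have := hanti.reflect_lt (hB v' hv'.1 i) (hB v hv.1 i) h
      simpa [neg_dotProduct] using this
  filter_upwards [hcore, hβhat] with ω hω hmle
  have hbound : ∀ᶠ n : ℕ in atTop, (((n : ℝ)⁻¹ *
      (GLM.logLik b u w (GLM.subDesign x α) n (fun k => y k ω) (βhat n ω)
        - GLM.logLik b u w x n (fun k => y k ω) β₀) : ℝ) : EReal) ≤ ((-(W * c₂ / 2) : ℝ) : EReal) := by
    filter_upwards [hω, hmle, eventually_gt_atTop 0] with n hn hmn hn0
    rw [EReal.coe_le_coe_iff, GLM.logLik_subDesign]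
    have h := hn (GLM.augment α (βhat n ω)) ⟨hmn.1, hrα _⟩
    have hn0' : (0 : ℝ) < n := by exact_mod_cast hn0
    have hdiff : GLM.logLik b u w x n (fun k => y k ω) (GLM.augment α (βhat n ω))
        - GLM.logLik b u w x n (fun k => y k ω) β₀ = 2 * W * ∑ i ∈ Finset.range n,
          w i / (2 * W) * GLM.llr b (u (x i ⬝ᵥ β₀)) (u (x i ⬝ᵥ GLM.augment α (βhat n ω)))
            (y i ω) := by
      simp only [GLM.logLik]
      rw [← Finset.sum_sub_distrib, Finset.mul_sum]
      refine Finset.sum_congr rfl fun i _ => ?_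
      unfold GLM.llr
      field_simp
      ring
    rw [hdiff, inv_mul_le_iff₀ hn0']
    nlinarith
  refine lt_of_le_of_lt (limsup_le_of_le (by isBoundedDefault) hbound) ?_
  have : -(W * c₂ / 2) < 0 := by
    have := mul_pos hW hc₂
    linarith
  exact_mod_cast this
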